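/- The game Influence is played on a finite directed graph $G$ whose vertex set $V(G)$ is partitioned into two sets $L$ and $R$. Left and Right move alternately. On her turn Left chooses some $x\in L$ and removes $x$ together with all vertices reachable from $x$ by a directed path ($\mathrm{Succ}(G,x)$); on his turn Right chooses some $y\in R$ and removes $y$ together with all vertices from which $y$ is reachable ($\mathrm{Pred}(G,y)$). A player's score is the number of vertices he or she removes; when a player has no vertex of his or her own label left, the opponent gains all remaining vertices. Let $Ls(G)$ (resp. $Rs(G)$) be the score of Left minus the score of Right, under optimal play, when Left (resp. Right) starts. After a move, a remaining $L$-vertex from which only $L$-vertices can be reached, or a remaining $R$-vertex that can be reached only from $R$-vertices, is called forced. For $v\in V(G)$, let $\mathrm{Rmv}(G,v)$ be the set of the vertices removed by playing $v$ together with the vertices that are forced after this move, and let $G_v=G\setminus \mathrm{Rmv}(G,v)$. A segment is a directed graph whose vertices are at least two consecutive integers, where $L$ is the set of its even and $R$ the set of its odd vertices, and whose arcs are exactly the arcs from each even vertex to the vertices at distance $1$ from it. An alternating directed cycle is obtained from a segment with an even number of vertices by adding the arc from its endpoint in $L$ to its endpoint in $R$. Let $G$ be an alternating directed cycle with at least $6$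 vertices. Then $Ls(G)\in\{0,2\}$. Moreover, if $|L|$ is odd, then $Ls(G)=0$. Furthermore, every first move leads to a segment: for every $x\in L$, we have $|\mathrm{Rmv}(G,x)|=3$, the graph $G_x$ is isomorphic (respecting $L$, $R$ and the arcs) to a segment with an odd number of vertices and $|L|-|R|=1$, and $Ls(G)=3+Rs(G_x)$; symmetrically, for every $y\in R$, we have $|\mathrm{Rmv}(G,y)|=3$, the graph $G_y$ is isomorphic to a segment with an odd number of vertices and $|L|-|R|=-1$, and $Rs(G)=-3+Ls(G_y)$. -/

import Mathlib

/-- A position of the game: a finite directed graph whose vertex set is partitioned into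
the `L`-vertices and the `R`-vertices. -/
structure InfluenceGraph (α : Type*) where
  L : Finset α
  R : Finset α
  disj : Disjoint L R
  Arc : α → α → Prop
  arc_mem : ∀ u v, Arc u v → (u ∈ L ∨ u ∈ R) ∧ (v ∈ L ∨ v ∈ R)

namespace InfluenceGraph

noncomputable section

open scoped Classical in
/-- The vertex set. -/
def verts {α : Type*} (G : InfluenceGraph α) : Finset α := G.L ∪ G.R

open scoped Classical in
/-- The induced subgraph on the vertices outside `S`. -/
def delete {α : Type*} (G : InfluenceGraph α) (S : Finset α) : InfluenceGraph α where
  L := G.L \ S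
  R := G.R \ S
  disj := G.disj.mono Finset.sdiff_subset Finset.sdiff_subset
  Arc u v := G.Arc u v ∧ u ∉ S ∧ v ∉ S
  arc_mem u v h := by
    obtain ⟨h1, h2, h3⟩ := h
    simpa [h2, h3] using G.arc_mem u v h1

open scoped Classical in
/-- The vertices that are reachable from `x` through a directed path, `x` included. -/
def succ {α : Type*} (G : InfluenceGraph α) (x : α) : Finset α :=
  G.verts.filter fun z => Relation.ReflTransGen G.Arc x z

open scoped Classical in
/-- The vertices that can reach `x` through a directed path, `x` included. -/
def pred {α : Type*} (G : InfluenceGraph α) (x : α) : Finset α :=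
  G.verts.filter fun z => Relation.ReflTransGen G.Arc z x

theorem card_delete_succ_lt {α : Type*} (G : InfluenceGraph α) {x : α} (hx : x ∈ G.L) :
    (G.delete (G.succ x)).verts.card < G.verts.card := by
  classical
  have hxv : x ∈ G.verts := by simp [verts, hx]
  have hxs : x ∈ G.succ x := by simp [succ, hxv, Relation.ReflTransGen.refl]
  refine Finset.card_lt_card ((Finset.ssubset_iff_of_subset ?_).2 ⟨x, hxv, ?_⟩)
  · intro z hz
    simp only [verts, delete, Finset.mem_union, Finset.mem_sdiff] at hz ⊢
    tauto
  · simp [verts, delete, hxs]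

theorem card_delete_pred_lt {α : Type*} (G : InfluenceGraph α) {y : α} (hy : y ∈ G.R) :
    (G.delete (G.pred y)).verts.card < G.verts.card := by
  classical
  have hyv : y ∈ G.verts := by simp [verts, hy]
  have hys : y ∈ G.pred y := by simp [pred, hyv, Relation.ReflTransGen.refl]
  refine Finset.card_lt_card ((Finset.ssubset_iff_of_subset ?_).2 ⟨y, hyv, ?_⟩)
  · intro z hz
    simp only [verts, delete, Finset.mem_union, Finset.mem_sdiff] at hz ⊢
    tauto
  · simp [verts, delete, hys]

mutual

/-- The maximum score of Left when Left starts. Without `L`-vertices Left gains nothing. -/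
def sL1 {α : Type*} (G : InfluenceGraph α) : ℕ :=
  if h : G.L.Nonempty then
    G.L.attach.sup' ((Finset.attach_nonempty_iff).2 h)
      fun x => (G.succ x.1).card + sL2 (G.delete (G.succ x.1))
  else 0
termination_by G.verts.card
decreasing_by exact G.card_delete_succ_lt x.2

/-- The maximum score of Left when Right starts. Without `R`-vertices Left gains everything. -/
def sL2 {α : Type*} (G : InfluenceGraph α) : ℕ :=
  if h : G.R.Nonempty then
    G.R.attach.inf' ((Finset.attach_nonempty_iff).2 h)
      fun y => sL1 (G.delete (G.pred y.1))
  else G.verts.card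
termination_by G.verts.card
decreasing_by exact G.card_delete_pred_lt y.2

end

mutual

/-- The maximum score of Right when Right starts. Without `R`-vertices Right gains nothing. -/
def sR1 {α : Type*} (G : InfluenceGraph α) : ℕ :=
  if h : G.R.Nonempty then
    G.R.attach.sup' ((Finset.attach_nonempty_iff).2 h)
      fun y => (G.pred y.1).card + sR2 (G.delete (G.pred y.1))
  else 0
termination_by G.verts.card
decreasing_by exact G.card_delete_pred_lt y.2

/-- The maximum score of Right when Left starts. Without `L`-vertices Right gains everything. -/
def sR2 {α : Type*} (G : InfluenceGraph α) : ℕ :=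
  if h : G.L.Nonempty then
    G.L.attach.inf' ((Finset.attach_nonempty_iff).2 h)
      fun x => sR1 (G.delete (G.succ x.1))
  else G.verts.card
termination_by G.verts.card
decreasing_by exact G.card_delete_succ_lt x.2

end

/-- The Left-score: the relative score of Left when Left starts. -/
def Ls {α : Type*} (G : InfluenceGraph α) : ℤ := (G.sL1 : ℤ) - (G.sR2 : ℤ)

/-- The Right-score: the relative score of Left when Right starts. -/
def Rs {α : Type*} (G : InfluenceGraph α) : ℤ := (G.sL2 : ℤ) - (G.sR1 : ℤ)

open scoped Classical in
/-- The forced vertices: `L`-vertices all of whose successors are in `L`, and `R`-vertices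
all of whose predecessors are in `R`. -/
def forc {α : Type*} (G : InfluenceGraph α) : Finset α :=
  (G.L.filter fun x => G.succ x ⊆ G.L) ∪ (G.R.filter fun y => G.pred y ⊆ G.R)

open scoped Classical in
/-- The vertices removed by the move `x` of Left, those that become forced included. -/
def rmvL {α : Type*} (G : InfluenceGraph α) (x : α) : Finset α :=
  G.succ x ∪ (G.delete (G.succ x)).forc

open scoped Classical in
/-- The vertices removed by the move `y` of Right, those that become forced included. -/
def rmvR {α : Type*} (G : InfluenceGraph α) (y : α) : Finset α :=
  G.pred y ∪ (G.delete (G.pred y)).forc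

/-- The resulting relevant subgraph after the move `x` of Left. -/
def afterL {α : Type*} (G : InfluenceGraph α) (x : α) : InfluenceGraph α := G.delete (G.rmvL x)

/-- The resulting relevant subgraph after the move `y` of Right. -/
def afterR {α : Type*} (G : InfluenceGraph α) (y : α) : InfluenceGraph α := G.delete (G.rmvR y)

open scoped Classical in
/-- Isomorphism of positions: a bijection of the vertex sets that respects labels and arcs. -/
def Isom {α β : Type*} (G : InfluenceGraph α) (H : InfluenceGraph β) : Prop :=
  ∃ f : α → β, Set.InjOn f (G.verts : Set α) ∧ G.L.image f = H.L ∧ G.R.image f = H.R ∧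
    ∀ u ∈ G.verts, ∀ v ∈ G.verts, (G.Arc u v ↔ H.Arc (f u) (f v))

/-- Segments: at least two consecutive integers, the even ones in `L`, the odd ones in `R`, with
exactly the arcs from each even vertex to the neighbouring odd ones. -/
structure IsSegment (G : InfluenceGraph ℤ) : Prop where
  consecutive : ∀ i ∈ G.verts, ∀ j ∈ G.verts, ∀ k : ℤ, i ≤ k → k ≤ j → k ∈ G.verts
  two_le_card : 2 ≤ G.verts.card
  mem_L : ∀ i, i ∈ G.L ↔ i ∈ G.verts ∧ Even i
  mem_R : ∀ i, i ∈ G.R ↔ i ∈ G.verts ∧ Odd i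
  arc_iff : ∀ u v, G.Arc u v ↔ u ∈ G.L ∧ v ∈ G.R ∧ (v = u + 1 ∨ v = u - 1)

/-- The endpoints of a segment are its lowest and its largest integer. -/
def IsEndpoint (G : InfluenceGraph ℤ) (i : ℤ) : Prop :=
  IsLeast (G.verts : Set ℤ) i ∨ IsGreatest (G.verts : Set ℤ) i

/-- Segments with an odd number of vertices and one more `L`-vertex than `R`-vertices. -/
def IsPlusSegment (G : InfluenceGraph ℤ) : Prop :=
  G.IsSegment ∧ Odd G.verts.card ∧ (G.L.card : ℤ) - (G.R.card : ℤ) = 1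

/-- Segments with an odd number of vertices and one more `R`-vertex than `L`-vertices. -/
def IsMinusSegment (G : InfluenceGraph ℤ) : Prop :=
  G.IsSegment ∧ Odd G.verts.card ∧ (G.L.card : ℤ) - (G.R.card : ℤ) = -1

/-- Alternating directed cycles: a segment with an even number of vertices to which the arc from
its endpoint in `L` to its endpoint in `R` is added. -/
def IsCycle (G : InfluenceGraph ℤ) : Prop :=
  ∃ S : InfluenceGraph ℤ, S.IsSegment ∧ Even S.verts.card ∧
    ∃ x ∈ S.L, S.IsEndpoint x ∧ ∃ y ∈ S.R, S.IsEndpoint y ∧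
      G.L = S.L ∧ G.R = S.R ∧ ∀ u v, G.Arc u v ↔ (S.Arc u v ∨ (u = x ∧ v = y))

end

end InfluenceGraph

-- The game is constant-sum, so `Ls` and `Rs` obey one minimax recursion (`score_add_score`,
-- `le_Ls`, `Rs_le`): the mover gains the number of vertices removed and then loses the score of the
-- opponent, who moves next. On a bipartite position with all arcs from `L` to `R`, a move removes a
-- vertex and its neighbours, whoever plays it. So a position is just a finite set `V` of integers,
-- a move at `x` deletes `x - 1`, `x`, `x + 1`, and the players differ only in the parity of the `x`
-- they own.
--
-- On a cycle every first move removes three vertices and leaves a segment of fixed length; up to a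
-- shift by an even number it is always the same one, so the first move does not matter. No vertex
-- is forced, since every remaining vertex keeps a neighbour. Hence `Ls` is 3 minus the score of
-- Right, who starts in a segment where he owns one vertex fewer than Left. It remains to show that
-- this score is 1 or 3, and 3 if |L| is odd (`score_minus`).
--
-- Positions are sums of segments of three types relative to a player: `even`, `plus`, `minus`. A
-- sum consisting of segments and their negatives ("doubled") has score 0: the second player
-- mirrors, so the score is at most 0. The converse needs the almost doubled sums, with an
-- additional pair `even a`, `even (a + 1)` or `plus (a + 1)`, `minus a`, whose score is at most 2.
-- These bounds are proved together (`ScoreBounds`): in the extra pair a reply either creates new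
-- mirrored segments and a smaller extra pair, or no reply is needed because the position has become
-- doubled.
--
-- For the minority player's segment, a move takes 3 vertices and leaves two even segments, in which
-- the opponent can get at least 0; so the score is at most 3. Moving in the middle leaves equal
-- even segments (score 0 for the opponent) or two that differ by one step (at most 2), so the score
-- is at least 3 or 1. Parity excludes 2.

namespace InfluenceGraph

open Relation

-- The scores as a zero-sum minimax recursion

section Score

variable {α : Type*} (G : InfluenceGraph α)

theorem mem_verts {z : α} : z ∈ G.verts ↔ z ∈ G.L ∨ z ∈ G.R := by
  classical
  simp [verts]

open scoped Classical in
theorem verts_delete (S : Finset α) : (G.delete S).verts = G.verts \ S := by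
  ext z
  simp only [mem_verts, delete, Finset.mem_sdiff]
  tauto

theorem succ_subset_verts (x : α) : G.succ x ⊆ G.verts := by
  classical
  exact Finset.filter_subset _ _

theorem pred_subset_verts (x : α) : G.pred x ⊆ G.verts := by
  classical
  exact Finset.filter_subset _ _

theorem card_delete_add {S : Finset α} (hS : S ⊆ G.verts) :
    (G.delete S).verts.card + S.card = G.verts.card := by
  classical
  rw [verts_delete]
  exact Finset.card_sdiff_add_card_eq_card hS

/-- If `f + g` is constantly `N`, then the maximum of `f` and the minimum of `g` add up to `N`. -/
theorem sup'_add_inf' {ι : Type*} {s : Finset ι} (hs : s.Nonempty) (f g : ι → ℕ) (N : ℕ)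
    (h : ∀ i ∈ s, f i + g i = N) : s.sup' hs f + s.inf' hs g = N := by
  obtain ⟨i, hi, hfi⟩ := Finset.exists_mem_eq_sup' hs f
  obtain ⟨j, hj, hgj⟩ := Finset.exists_mem_eq_inf' hs g
  have h1 := Finset.le_sup' f hj
  have h2 := Finset.inf'_le g hi
  have := h i hi
  have := h j hj
  omega

/-- Every vertex ends up with exactly one player. The recursions for a player's maximum and for the
opponent's minimum run over the same moves, so the equality passes through `sup'` and `inf'`. It
reduces four scores to two. -/
theorem score_add_score :
    G.sL1 + G.sR2 = G.verts.card ∧ G.sL2 + G.sR1 = G.verts.card := by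
  induction hN : G.verts.card using Nat.strong_induction_on generalizing G with
  | _ N ih =>
  constructor
  · rw [sL1, sR2]
    split_ifs with h
    · refine sup'_add_inf' _ _ _ _ fun x _ => ?_
      have h1 := (ih _ (hN ▸ G.card_delete_succ_lt x.2) _ rfl).2
      have h2 := G.card_delete_add (G.succ_subset_verts x)
      omega
    · omega
  · rw [sL2, sR1]
    split_ifs with h
    · rw [add_comm]
      refine sup'_add_inf' _ _ _ _ fun x _ => ?_
      have h1 := (ih _ (hN ▸ G.card_delete_pred_lt x.2) _ rfl).1
      have h2 := G.card_delete_add (G.pred_subset_verts x)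
      omega
    · omega

theorem Ls_eq_two_mul : G.Ls = 2 * G.sL1 - G.verts.card := by
  have := G.score_add_score.1
  rw [Ls]
  omega

theorem Rs_eq_two_mul : G.Rs = G.verts.card - 2 * G.sR1 := by
  have := G.score_add_score.2
  rw [Rs]
  omega

theorem succ_add_Rs (x : α) : ((G.succ x).card : ℤ) + (G.delete (G.succ x)).Rs =
    2 * (((G.succ x).card + (G.delete (G.succ x)).sL2 : ℕ) : ℤ) - G.verts.card := by
  have h1 := (G.delete (G.succ x)).score_add_score.2
  have h2 := G.card_delete_add (G.succ_subset_verts x)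
  rw [Rs]
  push_cast
  omega

theorem neg_pred_add_Ls (y : α) : -((G.pred y).card : ℤ) + (G.delete (G.pred y)).Ls =
    G.verts.card - 2 * (((G.pred y).card + (G.delete (G.pred y)).sR2 : ℕ) : ℤ) := by
  have h1 := (G.delete (G.pred y)).score_add_score.1
  have h2 := G.card_delete_add (G.pred_subset_verts y)
  rw [Ls]
  push_cast
  omega

theorem le_Ls {x : α} (hx : x ∈ G.L) :
    ((G.succ x).card : ℤ) + (G.delete (G.succ x)).Rs ≤ G.Ls := by
  rw [succ_add_Rs, Ls_eq_two_mul, sL1, dif_pos ⟨x, hx⟩]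
  have := Finset.le_sup' (fun x : {x // x ∈ G.L} =>
    (G.succ x.1).card + sL2 (G.delete (G.succ x.1))) (Finset.mem_attach _ ⟨x, hx⟩)
  dsimp only at this
  omega

theorem Rs_le {y : α} (hy : y ∈ G.R) :
    G.Rs ≤ -((G.pred y).card : ℤ) + (G.delete (G.pred y)).Ls := by
  rw [neg_pred_add_Ls, Rs_eq_two_mul, sR1, dif_pos ⟨y, hy⟩]
  have := Finset.le_sup' (fun y : {y // y ∈ G.R} =>
    (G.pred y.1).card + sR2 (G.delete (G.pred y.1))) (Finset.mem_attach _ ⟨y, hy⟩)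
  dsimp only at this
  omega

theorem exists_Ls_eq (h : G.L.Nonempty) :
    ∃ x ∈ G.L, G.Ls = ((G.succ x).card : ℤ) + (G.delete (G.succ x)).Rs := by
  obtain ⟨x, -, hx⟩ := Finset.exists_mem_eq_sup' ((Finset.attach_nonempty_iff).2 h)
    fun x : {x // x ∈ G.L} => (G.succ x.1).card + sL2 (G.delete (G.succ x.1))
  exact ⟨x, x.2, by rw [succ_add_Rs, Ls_eq_two_mul, sL1, dif_pos h, hx]⟩

theorem exists_Rs_eq (h : G.R.Nonempty) :
    ∃ y ∈ G.R, G.Rs = -((G.pred y).card : ℤ) + (G.delete (G.pred y)).Ls := by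
  obtain ⟨y, -, hy⟩ := Finset.exists_mem_eq_sup' ((Finset.attach_nonempty_iff).2 h)
    fun y : {y // y ∈ G.R} => (G.pred y.1).card + sR2 (G.delete (G.pred y.1))
  exact ⟨y, y.2, by rw [neg_pred_add_Ls, Rs_eq_two_mul, sR1, dif_pos h, hy]⟩

theorem Ls_of_L_eq_empty (h : ¬ G.L.Nonempty) : G.Ls = -(G.verts.card : ℤ) := by
  rw [Ls_eq_two_mul, sL1, dif_neg h]
  simp

theorem Rs_of_R_eq_empty (h : ¬ G.R.Nonempty) : G.Rs = G.verts.card := by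
  rw [Rs_eq_two_mul, sR1, dif_neg h]
  simp

end Score

-- Invariance of scores and forced vertices under isomorphism

section Isomorphism

variable {α β : Type*} {G : InfluenceGraph α} {H : InfluenceGraph β} {f : α → β}

open scoped Classical in
/-- The map `f` is an isomorphism from `G` to `H`. -/
structure IsomBy (G : InfluenceGraph α) (H : InfluenceGraph β) (f : α → β) : Prop where
  inj : Set.InjOn f (G.verts : Set α)
  image_L : G.L.image f = H.L
  image_R : G.R.image f = H.R
  arc : ∀ u ∈ G.verts, ∀ v ∈ G.verts, (G.Arc u v ↔ H.Arc (f u) (f v))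

theorem IsomBy.isom (h : G.IsomBy H f) : G.Isom H := ⟨f, h.inj, h.image_L, h.image_R, h.arc⟩

theorem IsomBy.mem_L (h : G.IsomBy H f) {x : α} (hx : x ∈ G.L) : f x ∈ H.L := by
  classical
  exact h.image_L ▸ Finset.mem_image_of_mem f hx

theorem IsomBy.mem_R (h : G.IsomBy H f) {x : α} (hx : x ∈ G.R) : f x ∈ H.R := by
  classical
  exact h.image_R ▸ Finset.mem_image_of_mem f hx

theorem IsomBy.exists_L (h : G.IsomBy H f) {y : β} (hy : y ∈ H.L) : ∃ x ∈ G.L, f x = y := by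
  classical
  rw [← h.image_L] at hy
  simpa using hy

theorem IsomBy.exists_R (h : G.IsomBy H f) {y : β} (hy : y ∈ H.R) : ∃ x ∈ G.R, f x = y := by
  classical
  rw [← h.image_R] at hy
  simpa using hy

open scoped Classical in
theorem IsomBy.image_verts (h : G.IsomBy H f) : G.verts.image f = H.verts := by
  rw [verts, verts, Finset.image_union, h.image_L, h.image_R]

theorem IsomBy.card_verts (h : G.IsomBy H f) : G.verts.card = H.verts.card := by
  classical
  rw [← h.image_verts, Finset.card_image_of_injOn h.inj]

theorem IsomBy.reflTransGen (h : G.IsomBy H f) {u v : α} (huv : ReflTransGen G.Arc u v) :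
    ReflTransGen H.Arc (f u) (f v) := by
  induction huv with
  | refl => exact .refl
  | tail _ hbc ih =>
    have hm := G.arc_mem _ _ hbc
    simp only [← mem_verts] at hm
    exact ih.tail ((h.arc _ hm.1 _ hm.2).1 hbc)

theorem IsomBy.exists_reflTransGen (h : G.IsomBy H f) {u : α} (hu : u ∈ G.verts) {w : β}
    (huw : ReflTransGen H.Arc (f u) w) : ∃ v ∈ G.verts, f v = w ∧ ReflTransGen G.Arc u v := by
  classical
  induction huw with
  | refl => exact ⟨u, hu, rfl, .refl⟩
  | tail _ hbc ih =>
    obtain ⟨v, hv, rfl, huv⟩ := ih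
    have hm := (H.arc_mem _ _ hbc).2
    rw [← mem_verts, ← h.image_verts, Finset.mem_image] at hm
    obtain ⟨v', hv', rfl⟩ := hm
    exact ⟨v', hv', rfl, huv.tail ((h.arc _ hv _ hv').2 hbc)⟩

theorem IsomBy.reflTransGen_iff (h : G.IsomBy H f) {u v : α} (hu : u ∈ G.verts)
    (hv : v ∈ G.verts) : ReflTransGen H.Arc (f u) (f v) ↔ ReflTransGen G.Arc u v := by
  refine ⟨fun huv => ?_, h.reflTransGen⟩
  obtain ⟨v', hv', he, hr⟩ := h.exists_reflTransGen hu huv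
  rwa [h.inj hv' hv he] at hr

open scoped Classical in
theorem IsomBy.image_succ (h : G.IsomBy H f) {x : α} (hx : x ∈ G.verts) :
    (G.succ x).image f = H.succ (f x) := by
  ext w
  simp only [succ, ← h.image_verts, Finset.mem_image, Finset.mem_filter]
  constructor
  · rintro ⟨v, ⟨hv, hr⟩, rfl⟩
    exact ⟨⟨v, hv, rfl⟩, h.reflTransGen hr⟩
  · rintro ⟨⟨v, hv, rfl⟩, hr⟩
    exact ⟨v, ⟨hv, (h.reflTransGen_iff hx hv).1 hr⟩, rfl⟩

open scoped Classical in
theorem IsomBy.image_pred (h : G.IsomBy H f) {x : α} (hx : x ∈ G.verts) :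
    (G.pred x).image f = H.pred (f x) := by
  ext w
  simp only [pred, ← h.image_verts, Finset.mem_image, Finset.mem_filter]
  constructor
  · rintro ⟨v, ⟨hv, hr⟩, rfl⟩
    exact ⟨⟨v, hv, rfl⟩, h.reflTransGen hr⟩
  · rintro ⟨⟨v, hv, rfl⟩, hr⟩
    exact ⟨v, ⟨hv, (h.reflTransGen_iff hv hx).1 hr⟩, rfl⟩

open scoped Classical in
theorem IsomBy.delete (h : G.IsomBy H f) {S : Finset α} (hS : S ⊆ G.verts) :
    (G.delete S).IsomBy (H.delete (S.image f)) f := by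
  have hL : G.L ⊆ G.verts := fun z hz => G.mem_verts.2 (.inl hz)
  have hR : G.R ⊆ G.verts := fun z hz => G.mem_verts.2 (.inr hz)
  have key : ∀ z ∈ G.verts, (f z ∈ S.image f ↔ z ∈ S) := fun z hz => by
    rw [Finset.mem_image]
    exact ⟨fun ⟨w, hw, he⟩ => h.inj (hS hw) hz he ▸ hw, fun hzS => ⟨z, hzS, rfl⟩⟩
  refine ⟨h.inj.mono ?_, ?_, ?_, ?_⟩
  · rw [verts_delete]
    exact_mod_cast Finset.sdiff_subset
  · ext w
    simp only [InfluenceGraph.delete, ← h.image_L, Finset.mem_image, Finset.mem_sdiff]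
    constructor
    · rintro ⟨z, ⟨hz, hzS⟩, rfl⟩
      exact ⟨⟨z, hz, rfl⟩, fun hh => hzS ((key z (hL hz)).1 (Finset.mem_image.2 hh))⟩
    · rintro ⟨⟨z, hz, rfl⟩, hzS⟩
      exact ⟨z, ⟨hz, fun hh => hzS ⟨z, hh, rfl⟩⟩, rfl⟩
  · ext w
    simp only [InfluenceGraph.delete, ← h.image_R, Finset.mem_image, Finset.mem_sdiff]
    constructor
    · rintro ⟨z, ⟨hz, hzS⟩, rfl⟩
      exact ⟨⟨z, hz, rfl⟩, fun hh => hzS ((key z (hR hz)).1 (Finset.mem_image.2 hh))⟩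
    · rintro ⟨⟨z, hz, rfl⟩, hzS⟩
      exact ⟨z, ⟨hz, fun hh => hzS ⟨z, hh, rfl⟩⟩, rfl⟩
  · intro u hu v hv
    rw [verts_delete, Finset.mem_sdiff] at hu hv
    simp only [InfluenceGraph.delete, key u hu.1, key v hv.1, h.arc u hu.1 v hv.1]

theorem IsomBy.delete_succ (h : G.IsomBy H f) {x : α} (hx : x ∈ G.verts) :
    (G.delete (G.succ x)).IsomBy (H.delete (H.succ (f x))) f := by
  classical
  simpa [h.image_succ hx] using h.delete (G.succ_subset_verts x)

theorem IsomBy.delete_pred (h : G.IsomBy H f) {x : α} (hx : x ∈ G.verts) :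
    (G.delete (G.pred x)).IsomBy (H.delete (H.pred (f x))) f := by
  classical
  simpa [h.image_pred hx] using h.delete (G.pred_subset_verts x)

theorem IsomBy.card_succ (h : G.IsomBy H f) {x : α} (hx : x ∈ G.verts) :
    (G.succ x).card = (H.succ (f x)).card := by
  classical
  rw [← h.image_succ hx, Finset.card_image_of_injOn (h.inj.mono (G.succ_subset_verts x))]

theorem IsomBy.card_pred (h : G.IsomBy H f) {x : α} (hx : x ∈ G.verts) :
    (G.pred x).card = (H.pred (f x)).card := by
  classical
  rw [← h.image_pred hx, Finset.card_image_of_injOn (h.inj.mono (G.pred_subset_verts x))]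

/-- The scores are invariant under isomorphism. -/
theorem IsomBy.scores_eq (h : G.IsomBy H f) : G.Ls = H.Ls ∧ G.Rs = H.Rs := by
  induction hN : G.verts.card using Nat.strong_induction_on generalizing G H with
  | _ N ih =>
  constructor
  · have key : ∀ x ∈ G.L, ((G.succ x).card : ℤ) + (G.delete (G.succ x)).Rs =
        (H.succ (f x)).card + (H.delete (H.succ (f x))).Rs := fun x hx => by
      have hv : x ∈ G.verts := G.mem_verts.2 (.inl hx)
      rw [h.card_succ hv, (ih _ (hN ▸ G.card_delete_succ_lt hx) (h.delete_succ hv) rfl).2]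
    by_cases hG : G.L.Nonempty
    · apply le_antisymm
      · obtain ⟨x, hx, he⟩ := G.exists_Ls_eq hG
        rw [he, key x hx]
        exact H.le_Ls (h.mem_L hx)
      · obtain ⟨z, hz⟩ := hG
        obtain ⟨y, hy, he⟩ := H.exists_Ls_eq ⟨_, h.mem_L hz⟩
        obtain ⟨x, hx, rfl⟩ := h.exists_L hy
        rw [he, ← key x hx]
        exact G.le_Ls hx
    · have hH : ¬ H.L.Nonempty := fun ⟨y, hy⟩ => hG ((h.exists_L hy).imp fun _ hx => hx.1)
      rw [G.Ls_of_L_eq_empty hG, H.Ls_of_L_eq_empty hH, h.card_verts]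
  · have key : ∀ x ∈ G.R, -((G.pred x).card : ℤ) + (G.delete (G.pred x)).Ls =
        -((H.pred (f x)).card : ℤ) + (H.delete (H.pred (f x))).Ls := fun x hx => by
      have hv : x ∈ G.verts := G.mem_verts.2 (.inr hx)
      rw [h.card_pred hv, (ih _ (hN ▸ G.card_delete_pred_lt hx) (h.delete_pred hv) rfl).1]
    by_cases hG : G.R.Nonempty
    · apply le_antisymm
      · obtain ⟨z, hz⟩ := hG
        obtain ⟨y, hy, he⟩ := H.exists_Rs_eq ⟨_, h.mem_R hz⟩
        obtain ⟨x, hx, rfl⟩ := h.exists_R hy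
        rw [he, ← key x hx]
        exact G.Rs_le hx
      · obtain ⟨x, hx, he⟩ := G.exists_Rs_eq hG
        rw [he, key x hx]
        exact H.Rs_le (h.mem_R hx)
    · have hH : ¬ H.R.Nonempty := fun ⟨y, hy⟩ => hG ((h.exists_R hy).imp fun _ hx => hx.1)
      rw [G.Rs_of_R_eq_empty hG, H.Rs_of_R_eq_empty hH, h.card_verts]

/-- No vertex is forced if every vertex of an isomorphic bipartite position has a neighbour. -/
theorem IsomBy.forc_eq_empty (h : G.IsomBy H f) (hL : ∀ u ∈ H.L, ∃ v ∈ H.R, H.Arc u v)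
    (hR : ∀ v ∈ H.R, ∃ u ∈ H.L, H.Arc u v) : G.forc = ∅ := by
  classical
  have hd := Finset.disjoint_left.1 G.disj
  rw [Finset.eq_empty_iff_forall_notMem]
  intro z hz
  simp only [forc, Finset.mem_union, Finset.mem_filter] at hz
  rcases hz with ⟨hz, hs⟩ | ⟨hz, hs⟩
  · obtain ⟨w, hw, ha⟩ := hL _ (h.mem_L hz)
    obtain ⟨v, hv, rfl⟩ := h.exists_R hw
    have hv' := G.mem_verts.2 (.inr hv)
    refine hd (hs ?_) hv
    exact Finset.mem_filter.2 ⟨hv', .single ((h.arc _ (G.mem_verts.2 (.inl hz)) _ hv').2 ha)⟩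
  · obtain ⟨w, hw, ha⟩ := hR _ (h.mem_R hz)
    obtain ⟨v, hv, rfl⟩ := h.exists_L hw
    have hv' := G.mem_verts.2 (.inl hv)
    refine hd hv (hs ?_)
    exact Finset.mem_filter.2 ⟨hv', .single ((h.arc _ hv' _ (G.mem_verts.2 (.inr hz))).2 ha)⟩

end Isomorphism

-- Moves when all arcs go from `L` to `R`

section Bipartite

variable {α : Type*} {G : InfluenceGraph α} {x z : α}

/-- Directed paths have length at most one, since a second arc would have to start in `R`. -/
theorem mem_succ_of_bipartite (hG : ∀ u v, G.Arc u v → u ∈ G.L ∧ v ∈ G.R) :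
    z ∈ G.succ x ↔ z ∈ G.verts ∧ (z = x ∨ G.Arc x z) := by
  classical
  refine Finset.mem_filter.trans (and_congr_right fun hz => ⟨fun h => ?_, ?_⟩)
  · clear hz
    induction h with
    | refl => exact .inl rfl
    | tail _ hbc ih =>
      rcases ih with rfl | ih
      · exact .inr hbc
      · exact absurd (hG _ _ ih).2 (Finset.disjoint_left.1 G.disj (hG _ _ hbc).1)
  · rintro (rfl | h)
    · exact .refl
    · exact .single h

theorem mem_pred_of_bipartite (hG : ∀ u v, G.Arc u v → u ∈ G.L ∧ v ∈ G.R) :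
    z ∈ G.pred x ↔ z ∈ G.verts ∧ (z = x ∨ G.Arc z x) := by
  classical
  refine Finset.mem_filter.trans (and_congr_right fun hz => ⟨fun h => ?_, ?_⟩)
  · clear hz
    induction h using ReflTransGen.head_induction_on with
    | refl => exact .inl rfl
    | head hab _ ih =>
      rcases ih with rfl | ih
      · exact .inr hab
      · exact absurd (hG _ _ hab).2 (Finset.disjoint_left.1 G.disj (hG _ _ ih).1)
  · rintro (rfl | h)
    · exact .refl
    · exact .single h

theorem mem_delete_L {S : Finset α} : z ∈ (G.delete S).L ↔ z ∈ G.L ∧ z ∉ S := by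
  classical
  exact Finset.mem_sdiff

theorem mem_delete_R {S : Finset α} : z ∈ (G.delete S).R ↔ z ∈ G.R ∧ z ∉ S := by
  classical
  exact Finset.mem_sdiff

theorem mem_delete_verts {S : Finset α} : z ∈ (G.delete S).verts ↔ z ∈ G.verts ∧ z ∉ S := by
  rw [mem_verts, mem_verts, mem_delete_L, mem_delete_R, or_and_right]

theorem rmvL_eq_succ (h : (G.delete (G.succ x)).forc = ∅) : G.rmvL x = G.succ x := by
  classical
  rw [rmvL, h]
  exact Finset.union_empty _

theorem rmvR_eq_pred (h : (G.delete (G.pred x)).forc = ∅) : G.rmvR x = G.pred x := by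
  classical
  rw [rmvR, h]
  exact Finset.union_empty _

end Bipartite

-- Positions as sets of integers, symmetric in the two players

section AlternatingPaths

/-- The position on a finite set of integers: the even ones are in `L`, the odd ones in `R`, with
the arcs from each even integer to the neighbouring odd ones. -/
def alternating (V : Finset ℤ) : InfluenceGraph ℤ where
  L := V.filter fun x => Even x
  R := V.filter fun x => Odd x
  disj := Finset.disjoint_filter.2 fun x _ h => Int.not_odd_iff_even.2 h
  Arc u v := u ∈ V ∧ v ∈ V ∧ Even u ∧ Odd v ∧ (v = u + 1 ∨ v = u - 1)
  arc_mem u v h := by simp [h.1, h.2.1, h.2.2.1, h.2.2.2.1]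

theorem mem_alternating_L {V : Finset ℤ} {x : ℤ} : x ∈ (alternating V).L ↔ x ∈ V ∧ Even x :=
  Finset.mem_filter

theorem mem_alternating_R {V : Finset ℤ} {x : ℤ} : x ∈ (alternating V).R ↔ x ∈ V ∧ Odd x :=
  Finset.mem_filter

theorem alternating_verts (V : Finset ℤ) : (alternating V).verts = V := by
  ext x
  rw [mem_verts, mem_alternating_L, mem_alternating_R, ← and_or_left]
  simp [Int.even_or_odd]

theorem alternating_arc_mem {V : Finset ℤ} (u v : ℤ) (h : (alternating V).Arc u v) :
    u ∈ (alternating V).L ∧ v ∈ (alternating V).R :=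
  ⟨mem_alternating_L.2 ⟨h.1, h.2.2.1⟩, mem_alternating_R.2 ⟨h.2.1, h.2.2.2.1⟩⟩

theorem alternating_succ {V : Finset ℤ} {x : ℤ} (hx : x ∈ V) (he : Even x) :
    (alternating V).succ x = V ∩ Finset.Icc (x - 1) (x + 1) := by
  ext z
  rw [mem_succ_of_bipartite alternating_arc_mem, alternating_verts]
  simp only [alternating, Finset.mem_inter, Finset.mem_Icc, hx, he,
    Int.odd_iff, true_and]
  rw [Int.even_iff] at he
  refine and_congr_right fun hz => ?_
  simp only [hz, true_and]
  omega

theorem alternating_pred {V : Finset ℤ} {x : ℤ} (hx : x ∈ V) (ho : Odd x) :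
    (alternating V).pred x = V ∩ Finset.Icc (x - 1) (x + 1) := by
  ext z
  rw [mem_pred_of_bipartite alternating_arc_mem, alternating_verts]
  simp only [alternating, Finset.mem_inter, Finset.mem_Icc, hx, ho,
    Int.even_iff, true_and]
  rw [Int.odd_iff] at ho
  refine and_congr_right fun hz => ?_
  simp only [hz, true_and]
  omega

/-- Positions given by sets of integers are closed under moves, so the whole game can be played on
sets. -/
theorem alternating_delete (V S : Finset ℤ) :
    (alternating V).delete (V ∩ S) = alternating (V \ S) := by
  simp only [alternating, delete, InfluenceGraph.mk.injEq]
  refine ⟨?_, ?_, ?_⟩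
  · ext z
    simp only [Finset.mem_sdiff, Finset.mem_filter, Finset.mem_inter]
    tauto
  · ext z
    simp only [Finset.mem_sdiff, Finset.mem_filter, Finset.mem_inter]
    tauto
  · ext u v
    simp only [Finset.mem_sdiff, Finset.mem_inter]
    tauto

/-- The integers that belong to a player: the even ones to Left (`true`), the odd ones to Right. -/
def Owns : Bool → ℤ → Prop
  | true, x => Even x
  | false, x => Odd x

/-- `V'` is a possible result of a move of the player `b` in the position on `V`. -/
def Step (b : Bool) (V V' : Finset ℤ) : Prop :=
  ∃ x ∈ V, Owns b x ∧ V' = V \ Finset.Icc (x - 1) (x + 1)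

/-- The relative score of the player `b`, who starts, in the position on `V`. -/
noncomputable def score : Bool → Finset ℤ → ℤ
  | true, V => (alternating V).Ls
  | false, V => -(alternating V).Rs

theorem score_parity (b : Bool) (V : Finset ℤ) : (score b V - V.card) % 2 = 0 := by
  cases b
  · rw [score, Rs_eq_two_mul, alternating_verts]
    omega
  · rw [score, Ls_eq_two_mul, alternating_verts]
    omega

theorem card_inter_add (V S : Finset ℤ) : (V ∩ S).card = (V.card : ℤ) - (V \ S).card := by
  have := Finset.card_sdiff_add_card_inter V S
  omega

theorem le_score {b : Bool} {V V' : Finset ℤ} (h : Step b V V') :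
    (V.card : ℤ) - V'.card - score (!b) V' ≤ score b V := by
  obtain ⟨x, hx, hb, rfl⟩ := h
  cases b
  · have := (alternating V).Rs_le (mem_alternating_R.2 ⟨hx, hb⟩)
    rw [alternating_pred hx hb, alternating_delete, card_inter_add] at this
    simp only [score, Bool.not_false]
    omega
  · have := (alternating V).le_Ls (mem_alternating_L.2 ⟨hx, hb⟩)
    rw [alternating_succ hx hb, alternating_delete, card_inter_add] at this
    simp only [score, Bool.not_true]
    omega

/-- The second alternative is the case of a player without vertices, when the opponent gains
everything. -/
theorem exists_score_eq (b : Bool) (V : Finset ℤ) :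
    (∃ V', Step b V V' ∧ score b V = (V.card : ℤ) - V'.card - score (!b) V') ∨
      score b V = -(V.card : ℤ) := by
  cases b
  · by_cases hR : (alternating V).R.Nonempty
    · obtain ⟨x, hx, he⟩ := (alternating V).exists_Rs_eq hR
      rw [mem_alternating_R] at hx
      refine .inl ⟨_, ⟨x, hx.1, hx.2, rfl⟩, ?_⟩
      rw [alternating_pred hx.1 hx.2, alternating_delete, card_inter_add] at he
      simp only [score, Bool.not_false]
      omega
    · right
      rw [score, Rs_of_R_eq_empty _ hR, alternating_verts]
  · by_cases hL : (alternating V).L.Nonempty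
    · obtain ⟨x, hx, he⟩ := (alternating V).exists_Ls_eq hL
      rw [mem_alternating_L] at hx
      refine .inl ⟨_, ⟨x, hx.1, hx.2, rfl⟩, ?_⟩
      rw [alternating_succ hx.1 hx.2, alternating_delete, card_inter_add] at he
      simp only [score, Bool.not_true]
      omega
    · right
      rw [score, Ls_of_L_eq_empty _ hL, alternating_verts]

theorem Step.card_lt {b : Bool} {V V' : Finset ℤ} (h : Step b V V') : V'.card < V.card := by
  obtain ⟨x, hx, -, rfl⟩ := h
  refine Finset.card_lt_card ((Finset.ssubset_iff_of_subset Finset.sdiff_subset).2 ⟨x, hx, ?_⟩)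
  simp

/-- To bound the score of the player who starts, it suffices to answer each of his moves. -/
theorem score_le {b : Bool} {V : Finset ℤ} {k : ℤ} (hk : 0 ≤ k)
    (h : ∀ V', Step b V V' → (V.card : ℤ) - V'.card - score (!b) V' ≤ k) : score b V ≤ k := by
  rcases exists_score_eq b V with ⟨V', hV', he⟩ | he
  · exact he ▸ h V' hV'
  · omega

end AlternatingPaths

-- Sums of segments and the moves in them

section Components

/-- The types of segments, relative to one of the players: those with `2 * n` vertices, those with
`n` vertices of the player and `n - 1` vertices of the opponent, and those with `n` vertices of
the opponent and `n - 1` vertices of the player. They are empty for `n = 0`. -/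
inductive SegType
  | even (n : ℕ)
  | plus (n : ℕ)
  | minus (n : ℕ)

namespace SegType

def size : SegType → ℕ
  | even n => 2 * n
  | plus n => 2 * n - 1
  | minus n => 2 * n - 1

/-- The type from the point of view of the opponent. -/
def neg : SegType → SegType
  | even n => even n
  | plus n => minus n
  | minus n => plus n

@[simp] theorem neg_neg (c : SegType) : c.neg.neg = c := by cases c <;> rfl

@[simp] theorem size_neg (c : SegType) : c.neg.size = c.size := by cases c <;> rfl

/-- `c.Move c₁ c₂` says that the player can move in a segment of type `c` so that segments of the
types `c₁` and `c₂` remain. -/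
inductive Move : SegType → SegType → SegType → Prop
  | even (i j : ℕ) : Move (even (i + j + 1)) (plus i) (even j)
  | plus (i j : ℕ) : Move (plus (i + j + 1)) (plus i) (plus j)
  | minus (i j : ℕ) : Move (minus (i + j + 2)) (even i) (even j)

/-- The interval of the size given by the type that starts at `p`. -/
noncomputable def interval (c : SegType) (p : ℤ) : Finset ℤ := Finset.Ico p (p + c.size)

theorem mem_interval {c : SegType} {p x : ℤ} : x ∈ c.interval p ↔ p ≤ x ∧ x < p + c.size :=
  Finset.mem_Ico

/-- The interval of type `c` that starts at `p` has the right owner of its first vertex. -/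
def StartsAt (b : Bool) : SegType → ℤ → Prop
  | even _, _ => True
  | plus _, p => Owns b p
  | minus _, p => Owns (!b) p

theorem startsAt_neg {b : Bool} {c : SegType} {p : ℤ} :
    StartsAt (!b) c.neg p ↔ StartsAt b c p := by
  cases c <;> simp [StartsAt, neg]

end SegType

open SegType

/-- No element of `S` equals or neighbours an element of `T`. -/
def Separated (S T : Finset ℤ) : Prop := ∀ x ∈ S, ∀ y ∈ T, x + 1 < y ∨ y + 1 < x

theorem Separated.symm {S T : Finset ℤ} (h : Separated S T) : Separated T S :=
  fun x hx y hy => (h y hy x hx).symm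

theorem Separated.mono_left {S S' T : Finset ℤ} (h : Separated S T) (hS : S' ⊆ S) :
    Separated S' T := fun x hx => h x (hS hx)

theorem Separated.union_left {S S' T : Finset ℤ} (h : Separated S T) (h' : Separated S' T) :
    Separated (S ∪ S') T := fun x hx => (Finset.mem_union.1 hx).elim (h x) (h' x)

theorem Separated.disjoint {S T : Finset ℤ} (h : Separated S T) : Disjoint S T :=
  Finset.disjoint_left.2 fun x hx hy => by
    have := h x hx x hy
    omega

/-- `V` is the union of pairwise separated intervals, whose types, from the point of view of the
player `b`, are the elements of the multiset. -/
inductive Splits (b : Bool) : Finset ℤ → Multiset SegType → Prop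
  | empty : Splits b ∅ 0
  | add {c : SegType} {p : ℤ} {V : Finset ℤ} {m : Multiset SegType} : StartsAt b c p →
      Separated (c.interval p) V → Splits b V m → Splits b (c.interval p ∪ V) ({c} + m)

variable {b : Bool} {V V' : Finset ℤ} {m n : Multiset SegType} {c c₁ c₂ : SegType}

/-- The decomposition into intervals stays; only the point of view changes. This lets statements for
the mover serve the opponent too. -/
theorem Splits.neg (h : Splits b V m) : Splits (!b) V (m.map SegType.neg) := by
  induction h with
  | empty => exact .empty
  | @add c p V m hc hs _ ih =>
    have : c.interval p = c.neg.interval p := by simp [interval]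
    rw [Multiset.map_add, Multiset.map_singleton, this]
    exact .add (startsAt_neg.2 hc) (this ▸ hs) ih

theorem Splits.card (h : Splits b V m) : V.card = (m.map size).sum := by
  induction h with
  | empty => rfl
  | @add c p V m hc hs _ ih =>
    rw [Finset.card_union_of_disjoint hs.disjoint, ih]
    simp [interval]

theorem Splits.extract (h : Splits b V ({c} + n)) : ∃ p V', StartsAt b c p ∧
    Separated (c.interval p) V' ∧ V = c.interval p ∪ V' ∧ Splits b V' n := by
  generalize hm : {c} + n = m at h
  induction h generalizing n with
  | empty => simp at hm
  | @add c₀ p V m hc hs hV ih =>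
    rw [Multiset.singleton_add, Multiset.singleton_add] at hm
    rcases Multiset.cons_eq_cons.1 hm with ⟨rfl, rfl⟩ | ⟨-, k, rfl, rfl⟩
    · exact ⟨p, V, hc, hs, rfl, hV⟩
    · obtain ⟨q, W, hq, hsq, rfl, hW⟩ := ih (Multiset.singleton_add _ _)
      refine ⟨q, c₀.interval p ∪ W, hq, ?_, Finset.union_left_comm _ _ _, ?_⟩
      · exact ((hs.symm.mono_left Finset.subset_union_left).symm.union_left
          hsq.symm).symm
      · rw [← Multiset.singleton_add]
        exact .add hc (hs.symm.mono_left Finset.subset_union_right).symm hW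

theorem Splits.exists_mem (h : Splits b V m) {x : ℤ} (hx : x ∈ V) : ∃ c n p V', m = {c} + n ∧
    StartsAt b c p ∧ Separated (c.interval p) V' ∧ V = c.interval p ∪ V' ∧ Splits b V' n ∧
    x ∈ c.interval p := by
  induction h with
  | empty => simp at hx
  | @add c₀ p V m hc hs hV ih =>
    rcases Finset.mem_union.1 hx with hx | hx
    · exact ⟨c₀, m, p, V, rfl, hc, hs, rfl, hV, hx⟩
    · obtain ⟨c, n, q, W, rfl, hq, hsq, rfl, hW, hxq⟩ := ih hx
      refine ⟨c, {c₀} + n, q, c₀.interval p ∪ W, add_left_comm _ _ _, hq, ?_,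
        Finset.union_left_comm _ _ _, ?_, hxq⟩
      · exact ((hs.symm.mono_left Finset.subset_union_left).symm.union_left
          hsq.symm).symm
      · exact .add hc (hs.symm.mono_left Finset.subset_union_right).symm hW

theorem owns_or_owns_not (b : Bool) (x : ℤ) : Owns b x ∨ Owns (!b) x := by
  cases b
  · exact (Int.even_or_odd x).symm
  · exact Int.even_or_odd x

theorem Owns.add_two_mul {x : ℤ} (h : Owns b x) (k : ℤ) : Owns b (x + 2 * k) := by
  cases b
  · exact Odd.add_even h (even_two_mul k)
  · exact Even.add h (even_two_mul k)

theorem Owns.exists_eq_add {x p : ℤ} (hx : Owns b x) (hp : Owns b p) (h : p ≤ x) :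
    ∃ i : ℕ, x = p + 2 * i := by
  refine ⟨((x - p) / 2).toNat, ?_⟩
  cases b <;> simp only [Owns, Int.even_iff, Int.odd_iff] at hx hp <;> omega

theorem Owns.exists_eq_add_one {x p : ℤ} (hx : Owns b x) (hp : Owns (!b) p) (h : p ≤ x) :
    ∃ i : ℕ, x = p + 2 * i + 1 := by
  refine ⟨((x - p) / 2).toNat, ?_⟩
  cases b <;> simp only [Owns, Int.even_iff, Int.odd_iff, Bool.not_false, Bool.not_true] at hx hp
    <;> omega

theorem Owns.not_add_one {p : ℤ} (hp : Owns (!b) p) (k : ℤ) : Owns b (p + 2 * k + 1) := by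
  cases b <;> simp only [Owns, Int.even_iff, Int.odd_iff, Bool.not_false, Bool.not_true] at hp ⊢
    <;> omega

/-- Removing `x` and its neighbours from an interval leaves two separated intervals. -/
theorem interval_sdiff {p p₂ x : ℤ} (h₁ : p + c₁.size = x - 1 ∨ c₁.size = 0 ∧ x - 1 ≤ p)
    (h₂ : p₂ = x + 2) (hp : p ≤ x ∧ x < p + c.size)
    (hc : p₂ + c₂.size = p + c.size ∨ c₂.size = 0 ∧ p + c.size ≤ p₂) :
    Separated (c₁.interval p) (c₂.interval p₂) ∧
      c.interval p \ Finset.Icc (x - 1) (x + 1) = c₁.interval p ∪ c₂.interval p₂ := by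
  constructor
  · intro u hu v hv
    rw [mem_interval] at hu hv
    omega
  · ext z
    simp only [Finset.mem_sdiff, Finset.mem_union, mem_interval, Finset.mem_Icc]
    omega

theorem SegType.exists_move {p x : ℤ} (hc : StartsAt b c p) (hx : x ∈ c.interval p)
    (hb : Owns b x) : ∃ c₁ c₂ p₁ p₂, c.Move c₁ c₂ ∧ StartsAt b c₁ p₁ ∧ StartsAt b c₂ p₂ ∧
      Separated (c₁.interval p₁) (c₂.interval p₂) ∧
      c.interval p \ Finset.Icc (x - 1) (x + 1) = c₁.interval p₁ ∪ c₂.interval p₂ := by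
  have hx2 : Owns b (x + 2) := hb.add_two_mul 1
  rw [mem_interval] at hx
  cases c with
  | even n =>
    simp only [size] at hx
    rcases owns_or_owns_not b p with hp | hp
    · obtain ⟨i, rfl⟩ := hb.exists_eq_add hp hx.1
      obtain ⟨j, rfl⟩ : ∃ j, n = i + j + 1 := ⟨n - i - 1, by omega⟩
      refine ⟨_, _, p, _, .even i j, hp, trivial, interval_sdiff ?_ rfl ?_ ?_⟩ <;>
        simp only [size] <;> omega
    · obtain ⟨j, rfl⟩ := hb.exists_eq_add_one hp hx.1
      obtain ⟨i, rfl⟩ : ∃ i, n = i + j + 1 := ⟨n - j - 1, by omega⟩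
      -- An even segment that starts with the opponent's vertex ends with the player's, so the
      -- `plus` piece lies on the right and the two pieces are exchanged.
      obtain ⟨hs, he⟩ := interval_sdiff (c := .even (i + j + 1)) (c₁ := .even j) (c₂ := .plus i)
        (p := p) (x := p + 2 * j + 1) (by simp only [size]; omega) rfl
        (by simp only [size]; omega) (by simp only [size]; omega)
      exact ⟨_, _, _, p, .even i j, hx2, trivial, hs.symm, he.trans (Finset.union_comm _ _)⟩
  | plus n =>
    simp only [size] at hx
    obtain ⟨i, rfl⟩ := hb.exists_eq_add hc hx.1
    obtain ⟨j, rfl⟩ : ∃ j, n = i + j + 1 := ⟨n - i - 1, by omega⟩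
    refine ⟨_, _, p, _, .plus i j, hc, hx2, interval_sdiff ?_ rfl ?_ ?_⟩ <;>
      simp only [size] <;> omega
  | minus n =>
    simp only [size] at hx
    obtain ⟨i, rfl⟩ := hb.exists_eq_add_one hc hx.1
    obtain ⟨j, rfl⟩ : ∃ j, n = i + j + 2 := ⟨n - i - 2, by omega⟩
    refine ⟨_, _, p, _, .minus i j, trivial, trivial, interval_sdiff ?_ rfl ?_ ?_⟩ <;>
      simp only [size] <;> omega

theorem SegType.Move.exists_owns {p : ℤ} (h : c.Move c₁ c₂) (hc : StartsAt b c p) :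
    ∃ x ∈ c.interval p, Owns b x ∧ ∃ p₁ p₂, StartsAt b c₁ p₁ ∧ StartsAt b c₂ p₂ ∧
      Separated (c₁.interval p₁) (c₂.interval p₂) ∧
      c.interval p \ Finset.Icc (x - 1) (x + 1) = c₁.interval p₁ ∪ c₂.interval p₂ := by
  simp only [mem_interval]
  cases h with
  | even i j =>
    rcases owns_or_owns_not b p with hp | hp
    · refine ⟨p + 2 * i, ?_, hp.add_two_mul i, p, _, hp, trivial, interval_sdiff ?_ rfl ?_ ?_⟩ <;>
        simp only [size] <;> omega
    · have hx := hp.not_add_one j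
      obtain ⟨hs, he⟩ := interval_sdiff (c := .even (i + j + 1)) (c₁ := .even j) (c₂ := .plus i)
        (p := p) (x := p + 2 * j + 1) (by simp only [size]; omega) rfl
        (by simp only [size]; omega) (by simp only [size]; omega)
      exact ⟨_, by simp only [size]; omega, hx, _, p, hx.add_two_mul 1, trivial, hs.symm,
        he.trans (Finset.union_comm _ _)⟩
  | plus i j =>
    have hx : Owns b (p + 2 * i) := Owns.add_two_mul hc i
    refine ⟨p + 2 * i, ?_, hx, p, _, hc, hx.add_two_mul 1, interval_sdiff ?_ rfl ?_ ?_⟩ <;>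
      simp only [size] <;> omega
  | minus i j =>
    refine ⟨p + 2 * i + 1, ?_, Owns.not_add_one hc i, p, _, trivial, trivial,
      interval_sdiff ?_ rfl ?_ ?_⟩ <;> simp only [size] <;> omega

theorem Separated.union_sdiff {S T : Finset ℤ} (h : Separated S T) {x : ℤ} (hx : x ∈ S) :
    (S ∪ T) \ Finset.Icc (x - 1) (x + 1) = S \ Finset.Icc (x - 1) (x + 1) ∪ T := by
  rw [Finset.union_sdiff_distrib]
  congr 1
  refine Finset.sdiff_eq_self_of_disjoint (Finset.disjoint_left.2 fun y hy hy' => ?_)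
  have := h x hx y hy
  rw [Finset.mem_Icc] at hy'
  omega

theorem Splits.add_two {S : Finset ℤ} {p₁ p₂ : ℤ} (h : Splits b V n) (hS : Separated S V)
    (h₁ : StartsAt b c₁ p₁) (h₂ : StartsAt b c₂ p₂)
    (hs : Separated (c₁.interval p₁) (c₂.interval p₂))
    (hsub : c₁.interval p₁ ∪ c₂.interval p₂ ⊆ S) :
    Splits b (c₁.interval p₁ ∪ c₂.interval p₂ ∪ V) ({c₁} + {c₂} + n) := by
  rw [Finset.union_assoc, add_assoc]
  refine .add h₁ ?_ (.add h₂ ?_ h)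
  · exact (hs.symm.union_left
      (hS.mono_left (Finset.subset_union_left.trans hsub)).symm).symm
  · exact hS.mono_left (Finset.subset_union_right.trans hsub)

theorem Splits.exists_move (h : Splits b V m) (hV : Step b V V') :
    ∃ c c₁ c₂ n, m = {c} + n ∧ c.Move c₁ c₂ ∧ Splits b V' ({c₁} + {c₂} + n) := by
  obtain ⟨x, hx, hb, rfl⟩ := hV
  obtain ⟨c, n, p, W, rfl, hc, hs, rfl, hW, hxc⟩ := h.exists_mem hx
  obtain ⟨c₁, c₂, p₁, p₂, hm, h₁, h₂, hs₁, he⟩ := SegType.exists_move hc hxc hb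
  refine ⟨c, c₁, c₂, n, rfl, hm, ?_⟩
  rw [hs.union_sdiff hxc, he]
  exact hW.add_two hs h₁ h₂ hs₁ (he ▸ Finset.sdiff_subset)

theorem Splits.exists_step (h : Splits b V ({c} + n)) (hm : c.Move c₁ c₂) :
    ∃ V', Step b V V' ∧ Splits b V' ({c₁} + {c₂} + n) := by
  obtain ⟨p, W, hc, hs, rfl, hW⟩ := h.extract
  obtain ⟨x, hx, hb, p₁, p₂, h₁, h₂, hs₁, he⟩ := hm.exists_owns hc
  refine ⟨_, ⟨x, Finset.mem_union_left _ hx, hb, rfl⟩, ?_⟩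
  rw [hs.union_sdiff hx, he]
  exact hW.add_two hs h₁ h₂ hs₁ (he ▸ Finset.sdiff_subset)

/-- The opponent moves in `c` as the player moves in `c.neg`. -/
theorem Splits.exists_step_not (h : Splits b V ({c} + n)) (hm : c.neg.Move c₁.neg c₂.neg) :
    ∃ V', Step (!b) V V' ∧ Splits b V' ({c₁} + {c₂} + n) := by
  have h' := h.neg
  rw [Multiset.map_add, Multiset.map_singleton] at h'
  obtain ⟨V', hV, hV'⟩ := h'.exists_step hm
  refine ⟨V', hV, ?_⟩
  have := hV'.neg
  simpa [Multiset.map_map, Function.comp_def] using this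

end Components

-- Mirroring strategies and bounds on the scores

section Strategies

open SegType

variable {b : Bool} {V V' V'' : Finset ℤ} {m n w d : Multiset SegType} {c c₁ c₂ : SegType}

theorem le_score_of_reply {k : ℤ} (h : Step (!b) V V') (hk : score b V' ≤ k) :
    (V.card : ℤ) - V'.card - k ≤ score (!b) V := by
  have := le_score h
  rw [Bool.not_not] at this
  omega

theorem singleton_add_singleton_eq {x y : SegType} (h : {x} + {y} = {c} + n) :
    c = x ∧ n = {y} ∨ c = y ∧ n = {x} := by
  have hc : c ∈ ({x} + {y} : Multiset SegType) := by simp [h]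
  rcases Multiset.mem_add.1 hc with hc | hc <;> rw [Multiset.mem_singleton] at hc <;> subst hc
  · exact .inl ⟨rfl, (add_left_cancel h).symm⟩
  · rw [add_comm] at h
    exact .inr ⟨rfl, (add_left_cancel h).symm⟩

theorem Splits.card_eq_of_move (h : Splits b V ({c} + n)) (h' : Splits b V' ({c₁} + {c₂} + n)) :
    (V.card : ℤ) - V'.card = c.size - c₁.size - c₂.size := by
  rw [h.card, h'.card]
  simp only [Multiset.map_add, Multiset.map_singleton, Multiset.sum_add, Multiset.sum_singleton]
  push_cast
  ring

theorem map_neg_map_neg (d : Multiset SegType) : (d.map SegType.neg).map SegType.neg = d := by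
  simp [Multiset.map_map]

/-- The multiset of segments of `d` together with their mirror images. -/
def doubled (d : Multiset SegType) : Multiset SegType := d + d.map SegType.neg

theorem doubled_add (d e : Multiset SegType) : doubled (d + e) = doubled d + doubled e := by
  simp only [doubled, Multiset.map_add]
  abel

theorem doubled_singleton (c : SegType) : doubled {c} = {c} + {c.neg} := rfl

theorem doubled_map_neg (d : Multiset SegType) : doubled (d.map SegType.neg) = doubled d := by
  rw [doubled, map_neg_map_neg, doubled, add_comm]

theorem map_neg_doubled (d : Multiset SegType) : (doubled d).map SegType.neg = doubled d := by
  rw [doubled, Multiset.map_add, map_neg_map_neg, add_comm]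

/-- An element of a doubled multiset may be assumed to lie in the first half. -/
theorem exists_doubled_eq (hc : c ∈ doubled d) : ∃ e, doubled d = doubled ({c} + e) := by
  rcases Multiset.mem_add.1 hc with hc | hc
  · obtain ⟨e, rfl⟩ := Multiset.exists_cons_of_mem hc
    exact ⟨e, rfl⟩
  · obtain ⟨e, he⟩ := Multiset.exists_cons_of_mem hc
    exact ⟨e, by rw [Multiset.singleton_add, ← he, doubled_map_neg]⟩

/-- A move in a doubled position is either in the rest, or the opponent can mirror it. -/
theorem Splits.exists_mirror (h : Splits b V (doubled d + w)) (hV : Step b V V') :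
    (∃ e V'', Step (!b) V' V'' ∧ Splits b V'' (doubled e + w) ∧
      (V.card : ℤ) - V'.card = V'.card - V''.card) ∨
    ∃ c c₁ c₂ n, w = {c} + n ∧ c.Move c₁ c₂ ∧ Splits b V' ({c₁} + {c₂} + (doubled d + n)) ∧
      (V.card : ℤ) - V'.card = c.size - c₁.size - c₂.size := by
  obtain ⟨c, c₁, c₂, n, hm, hc, hV'⟩ := h.exists_move hV
  have hcard := (hm ▸ h).card_eq_of_move hV'
  have hmem : c ∈ doubled d + w := by simp [hm]
  rcases Multiset.mem_add.1 hmem with hcd | hcw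
  · left
    obtain ⟨e, he⟩ := exists_doubled_eq hcd
    have hn : n = {c.neg} + (doubled e + w) := by
      rw [he, doubled_add, doubled_singleton, add_assoc, add_assoc] at hm
      exact (add_left_cancel hm).symm.trans (add_assoc _ _ _).symm |>.trans (add_assoc _ _ _)
    subst hn
    have hV₁ : Splits b V' ({c.neg} + ({c₁} + {c₂} + (doubled e + w))) := by
      convert hV' using 1
      abel
    obtain ⟨V'', hs, hV''⟩ := hV₁.exists_step_not (c₁ := c₁.neg) (c₂ := c₂.neg) (by simpa using hc)
    refine ⟨{c₁} + {c₂} + e, V'', hs, ?_, ?_⟩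
    · convert hV'' using 1
      simp only [doubled_add, doubled_singleton]
      abel
    · rw [hcard, hV₁.card_eq_of_move hV'']
      simp
  · right
    obtain ⟨k, rfl⟩ := Multiset.exists_cons_of_mem hcw
    refine ⟨c, c₁, c₂, k, rfl, hc, ?_, hcard⟩
    have hn : n = doubled d + k := by
      rw [← Multiset.singleton_add, add_left_comm] at hm
      exact (add_left_cancel hm).symm
    exact hn ▸ hV'

/-- The opponent of `b` answers in the component `c`. -/
theorem Splits.exists_reply (h : Splits b V m) (hm : m = {c} + n) (hc : c.neg.Move c₁.neg c₂.neg)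
    {m' : Multiset SegType} (hm' : m' = {c₁} + {c₂} + n) :
    ∃ V', Step (!b) V V' ∧ Splits b V' m' ∧
      (V.card : ℤ) - V'.card = c.size - c₁.size - c₂.size := by
  subst hm hm'
  obtain ⟨V', hs, hV'⟩ := h.exists_step_not hc
  exact ⟨V', hs, hV', h.card_eq_of_move hV'⟩

/-- The player `b` moves in the component `c`. -/
theorem Splits.exists_play (h : Splits b V m) (hm : m = {c} + n) (hc : c.Move c₁ c₂)
    {m' : Multiset SegType} (hm' : m' = {c₁} + {c₂} + n) :
    ∃ V', Step b V V' ∧ Splits b V' m' ∧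
      (V.card : ℤ) - V'.card = c.size - c₁.size - c₂.size := by
  subst hm hm'
  obtain ⟨V', hs, hV'⟩ := h.exists_step hc
  exact ⟨V', hs, hV', h.card_eq_of_move hV'⟩

/-- The bounds on the scores of the positions that the strategies of the opponent lead to. -/
structure ScoreBounds (b : Bool) (V : Finset ℤ) : Prop where
  le_zero : ∀ d, Splits b V (doubled d) → score b V ≤ 0
  zero_le : ∀ d, Splits b V (doubled d) → 0 ≤ score b V
  even : ∀ d a, Splits b V (doubled d + ({even a} + {even (a + 1)})) → score b V ≤ 2
  odd : ∀ d a, Splits b V (doubled d + ({plus (a + 1)} + {minus a})) → score b V ≤ 2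

theorem score_le_zero_of_doubled (ih : ∀ V', V'.card < V.card → ∀ b, ScoreBounds b V')
    (h : Splits b V (doubled d)) : score b V ≤ 0 := by
  refine score_le le_rfl fun V' hV' => ?_
  rw [← add_zero (doubled d)] at h
  rcases h.exists_mirror hV' with ⟨e, V'', hs, hV'', hcard⟩ | ⟨c, -, -, n, hn, -⟩
  · rw [add_zero] at hV''
    have := le_score_of_reply hs ((ih V'' (hs.card_lt.trans hV'.card_lt) b).le_zero e hV'')
    omega
  · simp at hn

theorem Splits.score_parity (h : Splits b V m) : (score b V - (m.map size).sum) % 2 = 0 := by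
  rw [← h.card]
  exact InfluenceGraph.score_parity b V

theorem sum_size_doubled (d : Multiset SegType) :
    ((doubled d).map size).sum = 2 * (d.map size).sum := by
  simp [doubled, Multiset.map_map, two_mul]

/-- The number of vertices is odd, because `minus 0` is empty and `plus 1` is a single vertex; the
bound 2 therefore improves to 1. It compensates for replies that remove only 2 vertices. -/
theorem ScoreBounds.le_one (h : ScoreBounds b V)
    (hV : Splits b V (doubled d + ({plus 1} + {minus 0}))) : score b V ≤ 1 := by
  have h1 := h.odd d 0 hV
  have h2 := hV.score_parity
  simp only [Multiset.map_add, Multiset.map_singleton, Multiset.sum_add, Multiset.sum_singleton,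
    sum_size_doubled, size] at h2
  push_cast at h2
  omega

theorem Splits.of_size_eq_zero (h : Splits b V ({c} + n)) (hc : c.size = 0) : Splits b V n := by
  obtain ⟨p, W, -, -, rfl, hW⟩ := h.extract
  simpa [interval, hc] using hW

/-- A move in one segment of the extra pair is answered in the other one so that the pieces pair up,
except for an extra pair of smaller size. -/
theorem score_le_two_of_even (ih : ∀ V', V'.card < V.card → ∀ b, ScoreBounds b V') {a : ℕ}
    (h : Splits b V (doubled d + ({even a} + {even (a + 1)}))) : score b V ≤ 2 := by
  refine score_le zero_le_two fun V' hV' => ?_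
  rcases h.exists_mirror hV' with ⟨e, V'', hs, hV'', hcard⟩ | ⟨c, c₁, c₂, n, hn, hm, hV₁, hcard⟩
  · have := le_score_of_reply hs ((ih V'' (hs.card_lt.trans hV'.card_lt) b).even e a hV'')
    omega
  · rcases singleton_add_singleton_eq hn with ⟨rfl, rfl⟩ | ⟨rfl, rfl⟩
    · cases hm with
      | even i j =>
        -- The reply cuts off `minus i` to match `plus i`, and removes as many vertices as the move
        -- did. The even remainders again differ by one.
        obtain ⟨V'', hs, hV'', hcard'⟩ := hV₁.exists_reply (c := even (i + j + 1 + 1))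
          (n := {plus i} + {even j} + doubled d) (c₁ := minus i) (c₂ := even (j + 1)) (by abel)
          (Move.even i (j + 1)) (m' := doubled (d + {plus i}) + ({even j} + {even (j + 1)}))
          (by rw [doubled_add, doubled_singleton]; simp only [SegType.neg]; abel)
        have := le_score_of_reply hs ((ih V'' (hs.card_lt.trans hV'.card_lt) b).even _ _ hV'')
        simp only [size] at hcard hcard'
        omega
    · generalize hk : a + 1 = k at hm
      cases hm with
      | even i j =>
        obtain rfl : a = i + j := by omega
        rcases j with _ | j
        · rcases i with _ | i
          -- Here `a = 0`: the move took both vertices of `even 1`. The gain of 2 is final, since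
          -- the rest is doubled.
          · have hV₂ : Splits b V' (doubled (d + {even 0})) := by
              refine Splits.of_size_eq_zero (c := plus 0) ?_ rfl
              convert hV₁ using 1
              rw [doubled_add, doubled_singleton]
              simp only [SegType.neg, add_zero]
              abel
            have := (ih V' hV'.card_lt (!b)).zero_le (d + {even 0}) (by
              rw [← map_neg_doubled]
              exact hV₂.neg)
            simp only [size] at hcard
            omega
          -- The move left no even piece, so `plus (i + 1)` cannot be matched exactly; the reply
          -- leaves `minus i`, an extra pair of the odd kind. For `i = 0` it removes 2 vertices
          -- against 3, and `le_one` makes up for it.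
          · obtain ⟨V'', hs, hV'', hcard'⟩ := hV₁.exists_reply (c := even (i + 1))
              (n := {plus (i + 1)} + {even 0} + doubled d) (c₁ := minus i) (c₂ := even 0)
              (by simp only [add_zero]; abel) (Move.even i 0)
              (m' := doubled (d + {even 0}) + ({plus (i + 1)} + {minus i}))
              (by rw [doubled_add, doubled_singleton]; simp only [SegType.neg]; abel)
            have hb := ih V'' (hs.card_lt.trans hV'.card_lt) b
            simp only [size] at hcard hcard'
            rcases i with _ | i
            · have := le_score_of_reply hs (hb.le_one hV'')
              omega
            · have := le_score_of_reply hs (hb.odd _ _ hV'')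
              omega
        · obtain ⟨V'', hs, hV'', hcard'⟩ := hV₁.exists_reply (c := even (i + (j + 1)))
            (n := {plus i} + {even (j + 1)} + doubled d) (c₁ := minus i) (c₂ := even j) (by abel)
            (Move.even i j) (m' := doubled (d + {plus i}) + ({even j} + {even (j + 1)}))
            (by rw [doubled_add, doubled_singleton]; simp only [SegType.neg]; abel)
          have := le_score_of_reply hs ((ih V'' (hs.card_lt.trans hV'.card_lt) b).even _ _ hV'')
          simp only [size] at hcard hcard'
          omega

/-- A move at the end of the `plus` segment gains at most 2 and leaves a doubled position. Any other
move in the extra pair gains 3 and is answered in its other segment. -/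
theorem score_le_two_of_odd (ih : ∀ V', V'.card < V.card → ∀ b, ScoreBounds b V') {a : ℕ}
    (h : Splits b V (doubled d + ({plus (a + 1)} + {minus a}))) : score b V ≤ 2 := by
  refine score_le zero_le_two fun V' hV' => ?_
  rcases h.exists_mirror hV' with ⟨e, V'', hs, hV'', hcard⟩ | ⟨c, c₁, c₂, n, hn, hm, hV₁, hcard⟩
  · have := le_score_of_reply hs ((ih V'' (hs.card_lt.trans hV'.card_lt) b).odd e a hV'')
    omega
  · rcases singleton_add_singleton_eq hn with ⟨rfl, rfl⟩ | ⟨rfl, rfl⟩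
    · generalize hk : a + 1 = k at hm
      cases hm with
      | plus i j =>
        obtain rfl : a = i + j := by omega
        clear hk hn
        wlog hij : i ≤ j generalizing i j
        · refine this j i ?_ ?_ ?_ (by omega)
          · rwa [add_comm j i]
          · rw [hcard, add_comm j i]
            ring
          · rwa [add_comm j i, add_comm {plus j}]
        rcases i with _ | i
        · have hV₂ : Splits b V' (doubled (d + {plus j})) := by
            refine Splits.of_size_eq_zero (c := plus 0) ?_ rfl
            convert hV₁ using 1
            rw [doubled_add, doubled_singleton]
            simp only [SegType.neg, zero_add]
            abel
          have := (ih V' hV'.card_lt (!b)).zero_le (d + {plus j}) (by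
            rw [← map_neg_doubled]
            exact hV₂.neg)
          simp only [size] at hcard
          omega
        · obtain ⟨j, rfl⟩ : ∃ k, j = k + 1 := ⟨j - 1, by omega⟩
          -- The reply leaves `minus (i + 1)` to match one piece, and `minus j` against `plus (j +
          -- 1)`. For `j = 0` it is a move at the end that removes only 2 vertices, whence `le_one`.
          obtain ⟨V'', hs, hV'', hcard'⟩ := hV₁.exists_reply (c := minus (i + 1 + (j + 1)))
            (n := {plus (i + 1)} + {plus (j + 1)} + doubled d) (c₁ := minus (i + 1))
            (c₂ := minus j) (by abel) (Move.plus (i + 1) j)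
            (m' := doubled (d + {plus (i + 1)}) + ({plus (j + 1)} + {minus j}))
            (by rw [doubled_add, doubled_singleton]; simp only [SegType.neg]; abel)
          have hb := ih V'' (hs.card_lt.trans hV'.card_lt) b
          simp only [size] at hcard hcard'
          rcases j with _ | j
          · have := le_score_of_reply hs (hb.le_one hV'')
            omega
          · have := le_score_of_reply hs (hb.odd _ _ hV'')
            omega
    · cases hm with
      | minus i j =>
        -- Even segments are their own negatives, so a second `even i` completes a mirrored pair.
        obtain ⟨V'', hs, hV'', hcard'⟩ := hV₁.exists_reply (c := plus (i + j + 2 + 1))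
          (n := {even i} + {even j} + doubled d) (c₁ := even i) (c₂ := even (j + 1)) (by abel)
          (Move.minus i (j + 1)) (m' := doubled (d + {even i}) + ({even j} + {even (j + 1)}))
          (by rw [doubled_add, doubled_singleton]; simp only [SegType.neg]; abel)
        have := le_score_of_reply hs ((ih V'' (hs.card_lt.trans hV'.card_lt) b).even _ _ hV'')
        simp only [size] at hcard hcard'
        omega

theorem SegType.Move.even_zero (a : ℕ) : (SegType.even (a + 1)).Move (.plus 0) (.even a) := by
  simpa using Move.even 0 a

theorem SegType.Move.plus_zero (a : ℕ) : (SegType.plus (a + 1)).Move (.plus 0) (.plus a) := by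
  simpa using Move.plus 0 a

theorem exists_doubled_eq_of_size_ne_zero (hd : (d.map size).sum ≠ 0) :
    ∃ e a, doubled d = doubled ({even (a + 1)} + e) ∨ doubled d = doubled ({plus (a + 1)} + e) := by
  obtain ⟨c, hc, h0⟩ : ∃ c ∈ d, c.size ≠ 0 := by
    by_contra! hall
    exact hd (Multiset.sum_eq_zero fun x hx => by
      obtain ⟨c, hc, rfl⟩ := Multiset.mem_map.1 hx
      exact hall c hc)
  obtain ⟨e, he⟩ := exists_doubled_eq (Multiset.mem_add.2 (.inl hc) : c ∈ doubled d)
  rcases c with (_ | a) | (_ | a) | (_ | a)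
  · exact absurd rfl h0
  · exact ⟨e, a, .inl he⟩
  · exact absurd rfl h0
  · exact ⟨e, a, .inr he⟩
  · exact absurd rfl h0
  · refine ⟨e, a, .inr ?_⟩
    rw [he, doubled_add, doubled_add, doubled_singleton, doubled_singleton]
    simp only [SegType.neg, add_comm]

/-- Playing the player's own end vertex of a nonempty segment gains 2 and leaves an almost doubled
position, worth at most 2 to the opponent. If the segment is a single vertex, both numbers drop to
1. -/
theorem zero_le_score_of_doubled (ih : ∀ V', V'.card < V.card → ∀ b, ScoreBounds b V')
    (h : Splits b V (doubled d)) : 0 ≤ score b V := by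
  by_cases h0 : (d.map size).sum = 0
  · have hV := h.card
    rw [sum_size_doubled, h0] at hV
    rcases exists_score_eq b V with ⟨V', hV', -⟩ | he
    · have := hV'.card_lt
      omega
    · omega
  · obtain ⟨e, a, he | he⟩ := exists_doubled_eq_of_size_ne_zero h0
    · rw [he, doubled_add, doubled_singleton] at h
      obtain ⟨V', hs, hV', hcard⟩ := h.exists_play (n := {even (a + 1)} + doubled e)
        (add_assoc _ _ _) (Move.even_zero a) rfl
      have hV₂ : Splits b V' (doubled e + ({even a} + {even (a + 1)})) := by
        refine Splits.of_size_eq_zero (c := plus 0) ?_ rfl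
        convert hV' using 1
        abel
      have hV₃ := hV₂.neg
      simp only [Multiset.map_add, map_neg_doubled, Multiset.map_singleton, SegType.neg] at hV₃
      have h1 := (ih V' hs.card_lt (!b)).even _ _ hV₃
      have h2 := le_score hs
      simp only [size] at hcard
      omega
    · rw [he, doubled_add, doubled_singleton] at h
      obtain ⟨V', hs, hV', hcard⟩ := h.exists_play (n := {minus (a + 1)} + doubled e)
        (add_assoc _ _ _) (Move.plus_zero a) rfl
      have hV₂ : Splits b V' (doubled e + ({minus (a + 1)} + {plus a})) := by
        refine Splits.of_size_eq_zero (c := plus 0) ?_ rfl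
        convert hV' using 1
        abel
      have hV₃ := hV₂.neg
      simp only [Multiset.map_add, map_neg_doubled, Multiset.map_singleton, SegType.neg] at hV₃
      have hb := ih V' hs.card_lt (!b)
      have h2 := le_score hs
      simp only [size] at hcard
      rcases a with _ | a
      · have h1 := hb.le_one hV₃
        omega
      · have h1 := hb.odd _ _ hV₃
        omega

theorem scoreBounds (b : Bool) (V : Finset ℤ) : ScoreBounds b V := by
  induction hN : V.card using Nat.strong_induction_on generalizing V b with
  | _ N ih =>
  subst hN
  have ih' : ∀ V' : Finset ℤ, V'.card < V.card → ∀ b, ScoreBounds b V' :=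
    fun V' hV' b => ih _ hV' b V' rfl
  exact ⟨fun _ => score_le_zero_of_doubled ih', fun _ => zero_le_score_of_doubled ih',
    fun _ _ => score_le_two_of_even ih', fun _ _ => score_le_two_of_odd ih'⟩

/-- Lower bounds for sums of two even segments, and of an odd segment, up to mirrored pairs. -/
theorem zero_le_score_and_score_le_three (V : Finset ℤ) :
    (∀ b d i j, Splits b V (doubled d + ({even i} + {even j})) → 0 ≤ score b V) ∧
    (∀ b d a, Splits b V (doubled d + {minus a}) → score b V ≤ 3) := by
  induction hN : V.card using Nat.strong_induction_on generalizing V with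
  | _ N ih =>
  subst hN
  constructor
  · intro b d i j h
    wlog hij : i ≤ j generalizing i j
    · exact this j i (by rwa [add_comm {even j}]) (by omega)
    obtain rfl | ⟨k, rfl⟩ : i = j ∨ ∃ k, j = i + k + 1 := by
      rcases hij.eq_or_lt with h | h
      · exact .inl h
      · exact .inr ⟨j - i - 1, by omega⟩
    · exact (scoreBounds b V).zero_le (d + {even i}) (by rwa [doubled_add, doubled_singleton])
    -- The longer segment is cut down to a copy of the shorter one. The surplus is `minus k` for the
    -- opponent, worth at most 3 to him, as much as the move gained; for `k = 0` the move gains 2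
    -- and the rest is doubled.
    · rw [add_comm i k] at h
      obtain ⟨V', hs, hV', hcard⟩ := h.exists_play (n := {even i} + doubled d)
        (by abel) (Move.even k i) (m' := doubled (d + {even i}) + {plus k})
        (by rw [doubled_add, doubled_singleton]; simp only [SegType.neg]; abel)
      have h1 := hV'.neg
      simp only [Multiset.map_add, map_neg_doubled, Multiset.map_singleton, SegType.neg] at h1
      have h2 := le_score hs
      simp only [size] at hcard
      rcases k with _ | k
      · rw [add_comm] at h1
        have := (scoreBounds (!b) V').le_zero _ (h1.of_size_eq_zero rfl)
        omega
      · have := (ih _ hs.card_lt V' rfl).2 _ _ _ h1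
        omega
  · intro b d a h
    refine score_le (by norm_num) fun V' hV' => ?_
    rcases h.exists_mirror hV' with
      ⟨e, V'', hs, hV'', hcard⟩ | ⟨c, c₁, c₂, n, hn, hm, hV₁, hcard⟩
    · have := le_score_of_reply hs ((ih _ (hs.card_lt.trans hV'.card_lt) V'' rfl).2 b e a hV'')
      omega
    · have hc : c ∈ ({minus a} : Multiset SegType) := by simp [hn]
      rw [Multiset.mem_singleton] at hc
      subst hc
      obtain rfl : n = 0 := by simpa using hn
      cases hm with
      | minus i j =>
        have h1 := hV₁.neg
        simp only [Multiset.map_add, map_neg_doubled, Multiset.map_singleton, SegType.neg,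
          add_zero] at h1
        rw [add_comm] at h1
        have := (ih _ hV'.card_lt V' rfl).1 _ _ _ _ h1
        simp only [size] at hcard
        omega

/-- The score of the player with fewer vertices, who starts, in a segment with `2 * n + 3`
vertices. -/
theorem score_minus {n : ℕ} (h : Splits b V {minus (n + 2)}) :
    (score b V = 1 ∨ score b V = 3) ∧ (Even n → score b V = 3) := by
  have h0 : Splits b V (doubled 0 + {minus (n + 2)}) := by simpa [doubled] using h
  have hle := (zero_le_score_and_score_le_three V).2 _ _ _ h0
  have hpar := h.score_parity
  simp only [Multiset.map_singleton, Multiset.sum_singleton, size] at hpar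
  -- Lower bound: play as near the middle as possible. The even pieces are then equal, or differ by
  -- one.
  rcases Nat.even_or_odd' n with ⟨k, rfl | rfl⟩
  · rw [two_mul] at h
    obtain ⟨V', hs, hV', hcard⟩ := h.exists_play (n := 0) (by simp) (Move.minus k k)
      (m' := doubled {even k}) (by rw [doubled_singleton]; simp [SegType.neg])
    have h1 := hV'.neg
    rw [map_neg_doubled] at h1
    have := (scoreBounds (!b) V').le_zero _ h1
    have := le_score hs
    simp only [size] at hcard
    have : score b V = 3 := by omega
    exact ⟨.inr this, fun _ => this⟩
  · rw [two_mul, show k + k + 1 = k + (k + 1) by ring] at h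
    obtain ⟨V', hs, hV', hcard⟩ := h.exists_play (n := 0) (by simp) (Move.minus k (k + 1))
      (m' := doubled 0 + ({even k} + {even (k + 1)})) (by simp [doubled])
    have h1 := hV'.neg
    simp only [Multiset.map_add, map_neg_doubled, Multiset.map_singleton, SegType.neg] at h1
    have := (scoreBounds (!b) V').even _ _ h1
    have := le_score hs
    simp only [size] at hcard
    refine ⟨by omega, fun hn => ?_⟩
    exact absurd hn (by simp)

end Strategies

-- Alternating cycles and the segments left by a first move

section Cycles

open SegType

theorem alternating_isomBy_add {q r t : ℤ} (ht : Even t) :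
    (alternating (Finset.Ico q r)).IsomBy (alternating (Finset.Ico (q + t) (r + t))) (· + t) := by
  rw [Int.even_iff] at ht
  refine ⟨(add_left_injective t).injOn, ?_, ?_, ?_⟩
  · ext w
    simp only [Finset.mem_image, mem_alternating_L, Finset.mem_Ico, Int.even_iff]
    refine ⟨?_, fun h => ⟨w - t, ?_, ?_⟩⟩
    · rintro ⟨a, h, rfl⟩
      omega
    all_goals omega
  · ext w
    simp only [Finset.mem_image, mem_alternating_R, Finset.mem_Ico, Int.odd_iff]
    refine ⟨?_, fun h => ⟨w - t, ?_, ?_⟩⟩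
    · rintro ⟨a, h, rfl⟩
      omega
    all_goals omega
  · intro u _ v _
    simp only [alternating, Finset.mem_Ico, Int.odd_iff, Int.even_iff]
    omega

/-- In an interval with `2 * m + 1` elements, the parity of the first one occurs `m + 1` times. -/
theorem card_filter_even {q : ℤ} (hq : Even q) (m : ℕ) :
    ((Finset.Ico q (q + 2 * m + 1)).filter fun z => Even z).card = m + 1 := by
  have : ((Finset.Ico q (q + 2 * m + 1)).filter fun z => Even z) =
      (Finset.range (m + 1)).image fun i : ℕ => q + 2 * i := by
    ext z
    simp only [Finset.mem_filter, Finset.mem_Ico, Finset.mem_image, Finset.mem_range]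
    rw [Int.even_iff] at *
    constructor
    · intro h
      exact ⟨((z - q) / 2).toNat, by omega, by omega⟩
    · rintro ⟨i, hi, rfl⟩
      omega
  rw [this, Finset.card_image_of_injective _ fun i j h => by simpa using h, Finset.card_range]

theorem card_filter_odd {q : ℤ} (hq : Odd q) (m : ℕ) :
    ((Finset.Ico q (q + 2 * m + 1)).filter fun z => Odd z).card = m + 1 := by
  have : ((Finset.Ico q (q + 2 * m + 1)).filter fun z => Odd z) =
      (Finset.range (m + 1)).image fun i : ℕ => q + 2 * i := by
    ext z
    simp only [Finset.mem_filter, Finset.mem_Ico, Finset.mem_image, Finset.mem_range]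
    rw [Int.odd_iff] at *
    constructor
    · intro h
      exact ⟨((z - q) / 2).toNat, by omega, by omega⟩
    · rintro ⟨i, hi, rfl⟩
      omega
  rw [this, Finset.card_image_of_injective _ fun i j h => by simpa using h, Finset.card_range]

theorem card_L_add_card_R {α : Type*} (G : InfluenceGraph α) :
    G.L.card + G.R.card = G.verts.card := by
  classical
  exact (Finset.card_union_of_disjoint G.disj).symm

theorem alternating_isSegment {q r : ℤ} (h : q + 2 ≤ r) :
    (alternating (Finset.Ico q r)).IsSegment where
  consecutive i hi j hj k hik hkj := by
    rw [alternating_verts, Finset.mem_Ico] at *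
    omega
  two_le_card := by
    rw [alternating_verts, Int.card_Ico]
    omega
  mem_L i := by rw [mem_alternating_L, alternating_verts]
  mem_R i := by rw [mem_alternating_R, alternating_verts]
  arc_iff u v := by
    rw [mem_alternating_L, mem_alternating_R]
    simp only [alternating]
    tauto

theorem alternating_isPlusSegment {q : ℤ} (hq : Even q) (m : ℕ) :
    (alternating (Finset.Ico q (q + 2 * (m + 1 : ℕ) + 1))).IsPlusSegment := by
  have hL : (alternating (Finset.Ico q (q + 2 * (m + 1 : ℕ) + 1))).L.card = m + 1 + 1 :=
    card_filter_even hq (m + 1)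
  have h := card_L_add_card_R (alternating (Finset.Ico q (q + 2 * (m + 1 : ℕ) + 1)))
  rw [alternating_verts, Int.card_Ico] at h
  refine ⟨alternating_isSegment (by omega), ?_, by omega⟩
  rw [alternating_verts, Int.card_Ico, Nat.odd_iff]
  omega

theorem alternating_isMinusSegment {q : ℤ} (hq : Odd q) (m : ℕ) :
    (alternating (Finset.Ico q (q + 2 * (m + 1 : ℕ) + 1))).IsMinusSegment := by
  have hR : (alternating (Finset.Ico q (q + 2 * (m + 1 : ℕ) + 1))).R.card = m + 1 + 1 :=
    card_filter_odd hq (m + 1)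
  have h := card_L_add_card_R (alternating (Finset.Ico q (q + 2 * (m + 1 : ℕ) + 1)))
  rw [alternating_verts, Int.card_Ico] at h
  refine ⟨alternating_isSegment (by omega), ?_, by omega⟩
  rw [alternating_verts, Int.card_Ico, Nat.odd_iff]
  omega

/-- Right has the minority in this segment: it is `plus (m + 2)` for Left, hence `minus (m + 2)` for
him. -/
theorem Rs_alternating {q : ℤ} (hq : Even q) (m : ℕ) :
    let r := (alternating (Finset.Ico q (q + 2 * (m + 1 : ℕ) + 1))).Rs
    (r = -1 ∨ r = -3) ∧ (Even m → r = -3) := by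
  intro r
  have h : Splits true (interval (plus (m + 2)) q ∪ ∅) ({plus (m + 2)} + 0) :=
    .add hq (fun _ _ y hy => by simp at hy) .empty
  have h' := h.neg
  have he : interval (plus (m + 2)) q = Finset.Ico q (q + 2 * (m + 1 : ℕ) + 1) := by
    rw [interval, size]
    congr 1
    omega
  rw [Finset.union_empty, he, add_zero, Multiset.map_singleton] at h'
  have hs := score_minus h'
  simp only [Bool.not_true, score] at hs
  refine ⟨by omega, fun hm => ?_⟩
  have := hs.2 hm
  omega

/-- Alternating cycles on an interval with `2 * n` elements. -/
structure IsCycleOn (G : InfluenceGraph ℤ) (p : ℤ) (n : ℕ) : Prop where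
  mem_L : ∀ z, z ∈ G.L ↔ (p ≤ z ∧ z < p + 2 * n) ∧ Even z
  mem_R : ∀ z, z ∈ G.R ↔ (p ≤ z ∧ z < p + 2 * n) ∧ Odd z
  arc : ∀ u v, G.Arc u v ↔ (p ≤ u ∧ u < p + 2 * n) ∧ (p ≤ v ∧ v < p + 2 * n) ∧ Even u ∧ Odd v ∧
    (v = u + 1 ∨ v = u - 1 ∨ v = u + 2 * n - 1 ∨ v = u - 2 * n + 1)

/-- The endpoints have opposite parities, so the added arc always joins them, from the even one to
the odd one; the offsets `± (2 * n - 1)` encode it. -/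
theorem IsCycle.exists_isCycleOn {G : InfluenceGraph ℤ} (hG : G.IsCycle) :
    ∃ p n, G.IsCycleOn p n := by
  obtain ⟨S, hS, hE, x, hx, hxe, y, hy, hye, hL, hR, hA⟩ := hG
  have hne : S.verts.Nonempty := Finset.card_pos.1 (by have := hS.two_le_card; omega)
  obtain ⟨p, hp⟩ : ∃ p, p = S.verts.min' hne := ⟨_, rfl⟩
  obtain ⟨q, hq⟩ : ∃ q, q = S.verts.max' hne := ⟨_, rfl⟩
  have hpl : IsLeast (S.verts : Set ℤ) p := hp ▸ S.verts.isLeast_min' hne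
  have hqg : IsGreatest (S.verts : Set ℤ) q := hq ▸ S.verts.isGreatest_max' hne
  have hV : S.verts = Finset.Icc p q := by
    ext z
    rw [Finset.mem_Icc]
    exact ⟨fun hz => ⟨hpl.2 hz, hqg.2 hz⟩, fun hz => hS.consecutive p hpl.1 q hqg.1 z hz.1 hz.2⟩
  obtain ⟨n, hn⟩ := hE
  have hc := hn
  rw [hV, Int.card_Icc] at hc
  have h2 := hS.two_le_card
  have hxe' : x = p ∨ x = q := hxe.imp (fun h => h.unique hpl) (fun h => h.unique hqg)
  have hye' : y = p ∨ y = q := hye.imp (fun h => h.unique hpl) (fun h => h.unique hqg)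
  have hx' := ((hS.mem_L x).1 hx).2
  have hy' := ((hS.mem_R y).1 hy).2
  have hmem : ∀ z, z ∈ S.verts ↔ p ≤ z ∧ z < p + 2 * n := fun z => by
    rw [hV, Finset.mem_Icc]
    omega
  have hmL : ∀ z, z ∈ S.L ↔ (p ≤ z ∧ z < p + 2 * n) ∧ Even z := fun z => by rw [hS.mem_L, hmem]
  have hmR : ∀ z, z ∈ S.R ↔ (p ≤ z ∧ z < p + 2 * n) ∧ Odd z := fun z => by rw [hS.mem_R, hmem]
  refine ⟨p, n, hL ▸ hmL, hR ▸ hmR, fun u v => ?_⟩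
  rw [hA, hS.arc_iff, hmL, hmR]
  simp only [Int.even_iff, Int.odd_iff] at *
  omega

namespace IsCycleOn

variable {G : InfluenceGraph ℤ} {p : ℤ} {n : ℕ} {x : ℤ} {T : Finset ℤ}

theorem mem_verts_iff (h : G.IsCycleOn p n) (z : ℤ) : z ∈ G.verts ↔ p ≤ z ∧ z < p + 2 * n := by
  rw [mem_verts, h.mem_L, h.mem_R, ← and_or_left]
  simp [Int.even_or_odd]

theorem card_verts (h : G.IsCycleOn p n) : G.verts.card = 2 * n := by
  have : G.verts = Finset.Ico p (p + 2 * n) := by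
    ext z
    rw [h.mem_verts_iff, Finset.mem_Ico]
  rw [this, Int.card_Ico]
  omega

theorem bipartite (h : G.IsCycleOn p n) (u v : ℤ) (ha : G.Arc u v) : u ∈ G.L ∧ v ∈ G.R := by
  rw [h.arc] at ha
  rw [h.mem_L, h.mem_R]
  tauto

/-- Removing a vertex and its neighbours from the cycle leaves a segment. -/
theorem delete_isomBy (h : G.IsCycleOn p n) (hn : 2 ≤ n) (hx : p ≤ x ∧ x < p + 2 * n)
    (hT : ∀ z, z ∈ T ↔ (p ≤ z ∧ z < p + 2 * n) ∧
      (z = x ∨ z = x + 1 ∨ z = x - 1 ∨ z = x + 2 * n - 1 ∨ z = x - 2 * n + 1)) :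
    (G.delete T).IsomBy (alternating (Finset.Ico (x + 2) (x + 2 * n - 1)))
      fun v => if v < x then v + 2 * n else v := by
  have hV : ∀ z ∈ (G.delete T).verts, (p ≤ z ∧ z < p + 2 * n) ∧
      ¬ (z = x ∨ z = x + 1 ∨ z = x - 1 ∨ z = x + 2 * n - 1 ∨ z = x - 2 * n + 1) := by
    intro z hz
    rw [mem_delete_verts, h.mem_verts_iff, hT] at hz
    tauto
  -- The map cuts the cycle open at `x` and moves the vertices before `x` behind the others; the
  -- shift `2 * n` preserves parity.
  refine ⟨fun u hu v hv he => ?_, ?_, ?_, fun u hu v hv => ?_⟩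
  · have := hV u hu
    have := hV v hv
    split_ifs at he <;> omega
  · ext w
    simp only [Finset.mem_image, mem_delete_L, mem_alternating_L, h.mem_L, hT,
      Finset.mem_Ico, Int.even_iff]
    constructor
    · rintro ⟨a, ha, rfl⟩
      split_ifs <;> omega
    · intro hw
      refine ⟨if w < p + 2 * n then w else w - 2 * n, ?_, ?_⟩
      · split_ifs <;> omega
      · split_ifs <;> omega
  · ext w
    simp only [Finset.mem_image, mem_delete_R, mem_alternating_R, h.mem_R, hT,
      Finset.mem_Ico, Int.odd_iff]
    constructor
    · rintro ⟨a, ha, rfl⟩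
      split_ifs <;> omega
    · intro hw
      refine ⟨if w < p + 2 * n then w else w - 2 * n, ?_, ?_⟩
      · split_ifs <;> omega
      · split_ifs <;> omega
  · have hu := hV u hu
    have hv := hV v hv
    simp only [delete, h.arc, hT, alternating, Finset.mem_Ico, Int.even_iff, Int.odd_iff]
    split_ifs <;> omega

theorem delete_card (h : G.IsCycleOn p n) (hn : 2 ≤ n) (hx : p ≤ x ∧ x < p + 2 * n)
    (hT : ∀ z, z ∈ T ↔ (p ≤ z ∧ z < p + 2 * n) ∧
      (z = x ∨ z = x + 1 ∨ z = x - 1 ∨ z = x + 2 * n - 1 ∨ z = x - 2 * n + 1)) : T.card = 3 := by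
  have h1 := G.card_delete_add (S := T) fun z hz => (h.mem_verts_iff z).2 ((hT z).1 hz).1
  have h2 := (h.delete_isomBy hn hx hT).card_verts
  rw [alternating_verts, Int.card_Ico] at h2
  rw [h.card_verts] at h1
  omega

theorem delete_forc (h : G.IsCycleOn p n) (hn : 3 ≤ n) (hx : p ≤ x ∧ x < p + 2 * n)
    (hT : ∀ z, z ∈ T ↔ (p ≤ z ∧ z < p + 2 * n) ∧
      (z = x ∨ z = x + 1 ∨ z = x - 1 ∨ z = x + 2 * n - 1 ∨ z = x - 2 * n + 1)) :
    (G.delete T).forc = ∅ := by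
  refine (h.delete_isomBy (by omega) hx hT).forc_eq_empty (fun u hu => ?_) fun v hv => ?_
  · simp only [mem_alternating_L, mem_alternating_R] at hu ⊢
    simp only [alternating, Finset.mem_Ico, Int.even_iff, Int.odd_iff] at hu ⊢
    -- The right neighbour serves, except at the last vertex. There the left one exists because `3 ≤
    -- n` leaves at least three vertices.
    by_cases hu' : u + 1 < x + 2 * n - 1
    · exact ⟨u + 1, by omega, by omega⟩
    · exact ⟨u - 1, by omega, by omega⟩
  · simp only [mem_alternating_L, mem_alternating_R] at hv ⊢
    simp only [alternating, Finset.mem_Ico, Int.even_iff, Int.odd_iff] at hv ⊢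
    by_cases hv' : v + 1 < x + 2 * n - 1
    · exact ⟨v + 1, by omega, by omega⟩
    · exact ⟨v - 1, by omega, by omega⟩

theorem mem_succ (h : G.IsCycleOn p n) (hx : x ∈ G.L) (z : ℤ) :
    z ∈ G.succ x ↔ (p ≤ z ∧ z < p + 2 * n) ∧
      (z = x ∨ z = x + 1 ∨ z = x - 1 ∨ z = x + 2 * n - 1 ∨ z = x - 2 * n + 1) := by
  rw [mem_succ_of_bipartite h.bipartite, h.mem_verts_iff, h.arc]
  rw [h.mem_L] at hx
  simp only [Int.even_iff, Int.odd_iff] at *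
  omega

theorem mem_pred (h : G.IsCycleOn p n) (hx : x ∈ G.R) (z : ℤ) :
    z ∈ G.pred x ↔ (p ≤ z ∧ z < p + 2 * n) ∧
      (z = x ∨ z = x + 1 ∨ z = x - 1 ∨ z = x + 2 * n - 1 ∨ z = x - 2 * n + 1) := by
  rw [mem_pred_of_bipartite h.bipartite, h.mem_verts_iff, h.arc]
  rw [h.mem_R] at hx
  simp only [Int.even_iff, Int.odd_iff] at *
  omega

theorem rmvL_eq (h : G.IsCycleOn p n) (hn : 3 ≤ n) (hx : x ∈ G.L) : G.rmvL x = G.succ x :=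
  rmvL_eq_succ (h.delete_forc hn ((h.mem_L x).1 hx).1 (h.mem_succ hx))

theorem rmvR_eq (h : G.IsCycleOn p n) (hn : 3 ≤ n) (hx : x ∈ G.R) : G.rmvR x = G.pred x :=
  rmvR_eq_pred (h.delete_forc hn ((h.mem_R x).1 hx).1 (h.mem_pred hx))

theorem card_L (h : G.IsCycleOn p n) (hn : 1 ≤ n) : G.L.card = n := by
  obtain ⟨m, rfl⟩ : ∃ m, n = m + 1 := ⟨n - 1, by omega⟩
  obtain ⟨q, hq, hpq⟩ : ∃ q, Even q ∧ (q = p ∨ q = p + 1 ∧ Odd p) := by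
    rcases Int.even_or_odd p with hp | hp
    · exact ⟨p, hp, .inl rfl⟩
    · exact ⟨p + 1, hp.add_one, .inr ⟨rfl, hp⟩⟩
  rw [← card_filter_even hq m]
  congr 1
  ext z
  rw [h.mem_L, Finset.mem_filter, Finset.mem_Ico]
  simp only [Int.even_iff, Int.odd_iff] at *
  omega

theorem nonempty_L (h : G.IsCycleOn p n) (hn : 1 ≤ n) : G.L.Nonempty :=
  Finset.card_pos.1 (by rw [h.card_L hn]; omega)

theorem nonempty_R (h : G.IsCycleOn p n) (hn : 1 ≤ n) : G.R.Nonempty := by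
  have h1 := card_L_add_card_R G
  rw [h.card_L hn, h.card_verts] at h1
  exact Finset.card_pos.1 (by omega)

theorem isomBy_delete_succ (h : G.IsCycleOn p n) (hn : 2 ≤ n) (hx : x ∈ G.L) :
    (G.delete (G.succ x)).IsomBy (alternating (Finset.Ico (x + 2) (x + 2 * n - 1)))
      fun v => if v < x then v + 2 * n else v :=
  h.delete_isomBy hn ((h.mem_L x).1 hx).1 (h.mem_succ hx)

theorem isomBy_delete_pred (h : G.IsCycleOn p n) (hn : 2 ≤ n) (hx : x ∈ G.R) :
    (G.delete (G.pred x)).IsomBy (alternating (Finset.Ico (x + 2) (x + 2 * n - 1)))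
      fun v => if v < x then v + 2 * n else v :=
  h.delete_isomBy hn ((h.mem_R x).1 hx).1 (h.mem_pred hx)

theorem card_succ (h : G.IsCycleOn p n) (hn : 2 ≤ n) (hx : x ∈ G.L) : (G.succ x).card = 3 :=
  h.delete_card hn ((h.mem_L x).1 hx).1 (h.mem_succ hx)

theorem card_pred (h : G.IsCycleOn p n) (hn : 2 ≤ n) (hx : x ∈ G.R) : (G.pred x).card = 3 :=
  h.delete_card hn ((h.mem_R x).1 hx).1 (h.mem_pred hx)

/-- The first move of Left does not matter. -/
theorem Ls_eq (h : G.IsCycleOn p n) (hn : 2 ≤ n) (hx : x ∈ G.L) :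
    G.Ls = 3 + (G.delete (G.succ x)).Rs := by
  obtain ⟨y, hy, he⟩ := G.exists_Ls_eq (h.nonempty_L (by omega))
  -- The segments left by `x` and by an optimal move `y` are translates by an even number.
  have ht : Even (x - y) := ((h.mem_L x).1 hx).2.sub ((h.mem_L y).1 hy).2
  rw [he, h.card_succ hn hy, (h.isomBy_delete_succ hn hy).scores_eq.2,
    (h.isomBy_delete_succ hn hx).scores_eq.2, (alternating_isomBy_add ht).scores_eq.2,
    show y + 2 + (x - y) = x + 2 by ring, show y + 2 * n - 1 + (x - y) = x + 2 * n - 1 by ring]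
  rfl

/-- The first move of Right does not matter. -/
theorem Rs_eq (h : G.IsCycleOn p n) (hn : 2 ≤ n) (hx : x ∈ G.R) :
    G.Rs = -3 + (G.delete (G.pred x)).Ls := by
  obtain ⟨y, hy, he⟩ := G.exists_Rs_eq (h.nonempty_R (by omega))
  have ht : Even (x - y) := ((h.mem_R x).1 hx).2.sub_odd ((h.mem_R y).1 hy).2
  rw [he, h.card_pred hn hy, (h.isomBy_delete_pred hn hy).scores_eq.1,
    (h.isomBy_delete_pred hn hx).scores_eq.1, (alternating_isomBy_add ht).scores_eq.1,
    show y + 2 + (x - y) = x + 2 by ring, show y + 2 * n - 1 + (x - y) = x + 2 * n - 1 by ring]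
  rfl

theorem Ls_values (h : G.IsCycleOn p (n + 3)) :
    (G.Ls = 0 ∨ G.Ls = 2) ∧ (Even n → G.Ls = 0) := by
  obtain ⟨x, hx⟩ := h.nonempty_L (by omega)
  have hx2 : Even (x + 2) := ((h.mem_L x).1 hx).2.add even_two
  have hs := Rs_alternating hx2 n
  rw [h.Ls_eq (by omega) hx, (h.isomBy_delete_succ (by omega) hx).scores_eq.2,
    show x + 2 * (n + 3 : ℕ) - 1 = x + 2 + 2 * (n + 1 : ℕ) + 1 by push_cast; ring]
  refine ⟨by omega, fun hn => ?_⟩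
  have := hs.2 hn
  omega

end IsCycleOn

end Cycles

end InfluenceGraph

theorem mainTheorem4 (G : InfluenceGraph ℤ) (hG : G.IsCycle) (hcard : 6 ≤ G.verts.card) :
    (G.Ls = 0 ∨ G.Ls = 2) ∧
    (Odd G.L.card → G.Ls = 0) ∧
    (∀ x ∈ G.L, (G.rmvL x).card = 3 ∧
      (∃ S : InfluenceGraph ℤ, S.IsPlusSegment ∧ (G.afterL x).Isom S) ∧
      G.Ls = 3 + (G.afterL x).Rs) ∧
    (∀ y ∈ G.R, (G.rmvR y).card = 3 ∧
      (∃ S : InfluenceGraph ℤ, S.IsMinusSegment ∧ (G.afterR y).Isom S) ∧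
      G.Rs = -3 + (G.afterR y).Ls) := by
  obtain ⟨p, k, h⟩ := hG.exists_isCycleOn
  rw [h.card_verts] at hcard
  obtain ⟨n, rfl⟩ : ∃ n, k = n + 3 := ⟨k - 3, by omega⟩
  have hr : ∀ x : ℤ, x + 2 * (n + 3 : ℕ) - 1 = x + 2 + 2 * (n + 1 : ℕ) + 1 := fun x => by
    push_cast
    ring
  refine ⟨h.Ls_values.1, fun ho => h.Ls_values.2 ?_, fun x hx => ?_, fun y hy => ?_⟩
  -- Since |L| is `n + 3`, it is odd exactly when `n` is even.
  · rw [h.card_L (by omega), Nat.odd_iff] at ho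
    rw [Nat.even_iff]
    omega
  · rw [InfluenceGraph.afterL, h.rmvL_eq (by omega) hx]
    refine ⟨h.card_succ (by omega) hx, ⟨_, ?_, (h.isomBy_delete_succ (by omega) hx).isom⟩,
      h.Ls_eq (by omega) hx⟩
    rw [hr]
    exact InfluenceGraph.alternating_isPlusSegment (((h.mem_L x).1 hx).2.add even_two) n
  · rw [InfluenceGraph.afterR, h.rmvR_eq (by omega) hy]
    refine ⟨h.card_pred (by omega) hy, ⟨_, ?_, (h.isomBy_delete_pred (by omega) hy).isom⟩,
      h.Rs_eq (by omega) hy⟩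
    rw [hr]
    exact InfluenceGraph.alternating_isMinusSegment (((h.mem_R y).1 hy).2.add_even even_two) n
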